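/- Let $(W,S)$ be a Coxeter system of type $H_3$, $H_4$ or $I_2(m)$ (with $2\le m<\infty$), and let $T=\bigcup_{g\in W} gSg^{-1}$ be its set of reflections. Let $c\in W$ be a Coxeter element, that is, a product, in some order, of the elements of a set $gSg^{-1}$ with $g\in W$. Let $(r_1,\dots,r_k)$ be a reduced reflection factorization of $c$, i.e. $r_i\in T$, $c=r_1\cdots r_k$, and $c$ is not a product of fewer than $k$ reflections. Let $\Gamma$ be its Carter diagram: its vertices are $1,\dots,k$, and distinct vertices $i,j$ are joined by $w_{ij}=m_{ij}-2$ edges, where $m_{ij}$ is the order of $r_ir_j$. A chordless cycle of $\Gamma$ is a full subgraph which is a cycle (of length $d\ge 3$). Then $W$ is isomorphic to the group $W(\Gamma)$ with one generator $t_i$ for every vertex $i$ of $\Gamma$, subject to the following relations: (R1) $t_i^2=1$ for all vertices $i$; (R2) $(t_it_j)^{m_{ij}}=1$ for all vertices $i\ne j$; (R3') for any chordless cycle $i_0 - i_1 - \cdots - i_{d-1} - i_0$ such that either all the weights $w_{i_0i_1},\dots,w_{i_{d-2}i_{d-1}},w_{i_{d-1}i_0}$ are $1$, or $w_{i_{d-1}i_0}=3$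 but not all of the other weights are $3$, $$(t_{i_0}t_{i_1}\cdots t_{i_{d-2}}t_{i_{d-1}}t_{i_{d-2}}\cdots t_{i_1})^2=1;$$ (R3'') for any chordless $3$-cycle $i_0 - i_1 - i_2 - i_0$ all of whose weights are $3$, $$(t_{i_0}t_{i_1}t_{i_2}t_{i_1})^3=1,\qquad (t_{i_1}t_{i_0}t_{i_1}t_{i_2}t_{i_1}t_{i_2})^2=1.$$ In (R3') and (R3'') all choices of starting vertex and direction of the cycle are allowed. -/

import Mathlib

namespace CarterPresentation

/-! ### Coxeter elements and reduced reflection factorizations -/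

section Factorizations

variable {B W : Type*} [Group W] {M : CoxeterMatrix B}

/-- `c` is a Coxeter element: the product, in some order, of the members of a simple system.
The simple systems of `W` are the conjugates `g S g⁻¹` of the set `S` of simple reflections. -/
def IsCoxeterElement (cs : CoxeterSystem M W) (c : W) : Prop :=
  ∃ (g : W) (l : List B), l.Nodup ∧ (∀ b, b ∈ l) ∧
    c = (l.map fun b => g * cs.simple b * g⁻¹).prod

/-- `(t₀, …, t_{k-1}) ∈ Red_T(w)`: a factorization `w = t₀ ⋯ t_{k-1}` into reflections with
the least possible number of factors. -/
structure IsReducedReflectionFactorization (cs : CoxeterSystem M W) (w : W) {k : ℕ}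
    (t : Fin k → W) : Prop where
  isReflection : ∀ i, cs.IsReflection (t i)
  prod_eq : (List.ofFn t).prod = w
  minimal : ∀ l : List W, (∀ x ∈ l, cs.IsReflection x) → l.prod = w → k ≤ l.length

end Factorizations

/-! ### Diagrams -/

/-- A diagram: distinct vertices `i`, `j` are joined by `weight i j` edges. -/
@[ext]
structure Diagram (V : Type*) where
  weight : V → V → ℕ
  symm : ∀ i j, weight i j = weight j i
  diag : ∀ i, weight i i = 0

lemma orderOf_mul_swap {G : Type*} [Group G] (a b : G) : orderOf (a * b) = orderOf (b * a) := by
  have h : SemiconjBy a (b * a) (a * b) := by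
    simp [SemiconjBy, mul_assoc]
  exact (h.orderOf_eq a).symm

/-- The Carter diagram of a tuple of reflections `t` of a finite Coxeter group: distinct vertices
`i`, `j` are joined by `m - 2` edges, where `m` is the order of `t i * t j`. -/
noncomputable def carterDiagram {W : Type*} [Group W] {k : ℕ} (t : Fin k → W) : Diagram (Fin k) where
  weight i j := if i = j then 0 else orderOf (t i * t j) - 2
  symm i j := by simp only [eq_comm (a := i), orderOf_mul_swap (t i)]
  diag i := by simp

namespace Diagram

variable {V : Type*} (Γ : Diagram V)

/-- The underlying simple graph: `i` and `j` are adjacent if at least one edge joins them. -/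
def graph : SimpleGraph V where
  Adj i j := Γ.weight i j ≠ 0
  symm := ⟨fun i j h => by rwa [Γ.symm j i]⟩
  loopless := ⟨fun i h => h (Γ.diag i)⟩

/-- `c` lists the vertices `c 0 - c 1 - ⋯ - c (d-1) - c 0` of a chordless cycle, that is, of a full
subgraph which is a cycle (with a choice of starting point and direction). -/
def IsChordlessCycle {d : ℕ} (c : Fin d → V) : Prop :=
  3 ≤ d ∧ Function.Injective c ∧
    ∀ a b : Fin d, Γ.graph.Adj (c a) (c b) ↔ (SimpleGraph.cycleGraph d).Adj a b

/-- `(R1)`: the words `t_i ^ 2`. -/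
def relR1 : Set (FreeGroup V) :=
  {r | ∃ i, r = FreeGroup.of i ^ 2}

/-- `(R2)`: the words `(t_i t_j) ^ m_ij` for `i ≠ j`, where `m_ij = weight i j + 2`. -/
def relR2 : Set (FreeGroup V) :=
  {r | ∃ i j, i ≠ j ∧ r = (FreeGroup.of i * FreeGroup.of j) ^ (Γ.weight i j + 2)}

/-- The word `t_{c 0} t_{c 1} ⋯ t_{c (d-2)} t_{c (d-1)} t_{c (d-2)} ⋯ t_{c 1}`. -/
def cycleWord {d : ℕ} (c : Fin d → V) : FreeGroup V :=
  let l := List.ofFn fun a => FreeGroup.of (c a)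
  l.prod * l.tail.dropLast.reverse.prod

/-- `(R3')`: for every chordless cycle `c 0 - ⋯ - c (d-1) - c 0` such that either all weights are
`1`, or the closing edge `c (d-1) - c 0` has weight `3` but not all the other edges have weight
`3`, the square of the cycle word.  (The length of the cycle is written as `d + 1`.) -/
def relR3' : Set (FreeGroup V) :=
  {r | ∃ (d : ℕ) (c : Fin (d + 1) → V), Γ.IsChordlessCycle c ∧
    (((∀ a : Fin d, Γ.weight (c a.castSucc) (c a.succ) = 1) ∧
        Γ.weight (c (Fin.last d)) (c 0) = 1) ∨
      (Γ.weight (c (Fin.last d)) (c 0) = 3 ∧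
        ¬ ∀ a : Fin d, Γ.weight (c a.castSucc) (c a.succ) = 3)) ∧
    r = cycleWord c ^ 2}

/-- `(R3'')`: for every chordless `3`-cycle `i₀ - i₁ - i₂ - i₀` all of whose weights are `3`, the
words `(t_{i₀} t_{i₁} t_{i₂} t_{i₁}) ^ 3` and
`(t_{i₁} t_{i₀} t_{i₁} t_{i₂} t_{i₁} t_{i₂}) ^ 2`.  (Three vertices joined pairwise by `3` edges are
distinct and always form a chordless cycle.) -/
def relR3'' : Set (FreeGroup V) :=
  {r | ∃ i₀ i₁ i₂ : V, Γ.weight i₀ i₁ = 3 ∧ Γ.weight i₁ i₂ = 3 ∧ Γ.weight i₂ i₀ = 3 ∧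
    (r = (FreeGroup.of i₀ * FreeGroup.of i₁ * FreeGroup.of i₂ * FreeGroup.of i₁) ^ 3 ∨
      r = (FreeGroup.of i₁ * FreeGroup.of i₀ * FreeGroup.of i₁ * FreeGroup.of i₂ *
        FreeGroup.of i₁ * FreeGroup.of i₂) ^ 2)}

/-- The group `W(Γ)` with one generator per vertex, subject to `(R1)`, `(R2)`, `(R3')`, `(R3'')`. -/
abbrev presentedGroup : Type _ :=
  PresentedGroup (relR1 ∪ Γ.relR2 ∪ Γ.relR3' ∪ Γ.relR3'')

end Diagram

/-- The Coxeter matrix `M` is, up to a relabelling of its index set, the one of type `H₃`, `H₄` or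
`I₂(m)` for some `2 ≤ m < ∞` (`CoxeterMatrix.I m` is the matrix of type `I₂(m + 2)`). -/
def IsTypeHOrI {B : Type*} (M : CoxeterMatrix B) : Prop :=
  (∃ e : B ≃ Fin 3, M.reindex e = CoxeterMatrix.H₃) ∨
  (∃ e : B ≃ Fin 4, M.reindex e = CoxeterMatrix.H₄) ∨
  (∃ (m : ℕ) (e : B ≃ Fin 2), M.reindex e = CoxeterMatrix.I m)

end CarterPresentation

/-! In the dihedral case the diagram has two vertices, and its only weight is the order of `t 0 * t
1 = c` minus 2, so its relations are the Coxeter relations (`nonempty_mulEquiv_of_dihedral`).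

For `H₃` and `H₄` the proof is a computation with the 15 or 60 reflections, never with the elements
of the group. Few diagrams occur: all Coxeter elements are conjugate (`isConj_prod_range`), a
reduced factorization has as many factors as the rank (`length_eq_rank`), and conjugation by powers
of `c` moves the first factor into a short list. An exhaustive search (`search_sound`) then shows
that every Carter diagram is, up to relabelling, one of three (`H₃`) or eight (`H₄`).

For each of these, a Todd–Coxeter argument is run on conjugates of the generators. If elements `g i`
of any group satisfy the relators, `exists_of_sweep` produces a family `y q`, indexed by the
positive roots and containing the `g i`, which the `g i` permute by conjugation as the reflections
of `W` are permuted. The members of the family then permute it in the same way (`isRep_of_isPath`).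
Such a family has the expected orders of products, because orders 2, 3 and 5 can be read off from
how two involutions conjugate each other (`pow_ord`).

In `W(Γ)` this gives the Coxeter relations for the `y i` at the simple roots, hence a map from `W`.
In `W` it gives the relators of `Γ`, hence a map back. The two maps exchange `y q` with the
reflection `x q`, so they are mutually inverse (`nonempty_mulEquiv`).

The root table is not assumed correct. The same enumeration, applied to the Coxeter diagram, labels
the reflections of the given `W` by positive roots, and the action of `W` on the roots shows that
the labels are distinct (`exists_realizes`). -/

namespace CarterPresentation

/-! ### Computing with packed tables -/

/-- Evaluates `n` to a literal before passing it on. -/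
def force {α : Type*} (n : ℕ) (f : ℕ → α) : α :=
  match n with
  | 0 => f 0
  | k + 1 => f (Nat.succ k)

theorem force_eq {α : Type*} (n : ℕ) (f : ℕ → α) : force n f = f n := by
  cases n <;> rfl

/-- Evaluates all entries of a list before passing it on. -/
def forceList {α : Type*} : List ℕ → (List ℕ → α) → α
  | [], f => f []
  | a :: l, f => force a fun a' => forceList l fun l' => f (a' :: l')

theorem forceList_eq {α : Type*} (l : List ℕ) (f : List ℕ → α) : forceList l f = f l := by
  induction l generalizing f with
  | nil => rfl
  | cons a l ih => simp [forceList, force_eq, ih]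

/-- Evaluates all entries of a list of lists before passing it on. -/
def forceLists {α : Type*} : List (List ℕ) → (List (List ℕ) → α) → α
  | [], f => f []
  | a :: l, f => forceList a fun a' => forceLists l fun l' => f (a' :: l')

theorem forceLists_eq {α : Type*} (l : List (List ℕ)) (f : List (List ℕ) → α) :
    forceLists l f = f l := by
  induction l generalizing f with
  | nil => rfl
  | cons a l ih => simp [forceLists, forceList_eq, ih]

/-- The `v`-th entry (in base `128`) of a packed table. -/
def entry (t v : ℕ) : ℕ := Nat.land (Nat.shiftRight t (Nat.mul 7 v)) 127

/-- The table with entries `l` in base `128`. -/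
def packRow (l : List ℕ) : ℕ := l.foldr (fun a r => Nat.add a (Nat.mul 128 r)) 0

def allLt (n : ℕ) (f : ℕ → Bool) : Bool := (List.range n).all f

theorem allLt_iff {n : ℕ} {f : ℕ → Bool} : allLt n f = true ↔ ∀ i < n, f i = true := by
  simp [allLt, List.all_eq_true]

/-- `hasBit m k` is the `k`-th binary digit of `m`. -/
def hasBit (m k : ℕ) : Bool := Nat.beq 1 (Nat.land 1 (Nat.shiftRight m k))

/-- `m` with the `k`-th binary digit set. -/
def setBit (m k : ℕ) : ℕ := Nat.lor m (Nat.shiftLeft 1 k)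

theorem hasBit_eq_testBit (m k : ℕ) : hasBit m k = m.testBit k := by
  have h : Nat.land 1 (Nat.shiftRight m k) = m / 2 ^ k % 2 := by
    change 1 &&& (m >>> k) = _
    rw [Nat.one_and_eq_mod_two, Nat.shiftRight_eq_div_pow]
  rw [hasBit, h, Nat.testBit_eq_decide_div_mod_eq]
  rcases Nat.mod_two_eq_zero_or_one (m / 2 ^ k) with h | h <;> rw [h] <;> rfl

theorem hasBit_setBit {m k j : ℕ} (h : hasBit (setBit m k) j = true) :
    j = k ∨ hasBit m j = true := by
  have h' : (m ||| 1 <<< k).testBit j = true := by rw [← hasBit_eq_testBit]; exact h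
  rw [Nat.testBit_or, Bool.or_eq_true, Nat.one_shiftLeft, Nat.testBit_two_pow] at h'
  rcases h' with h' | h'
  · exact .inr (by rwa [hasBit_eq_testBit])
  · exact .inl (by simpa using (of_decide_eq_true h').symm)

theorem hasBit_zero (k : ℕ) : hasBit 0 k = false := by simp [hasBit_eq_testBit]

/-! ### Tables of reflections -/

/-- The action of the reflections of a finite Coxeter group on its roots: the positive roots are
numbered `0, …, size - 1`, the first `rank` of them being the simple ones, `v + size` stands for
the negative of the root `v`, and the row `p` is the packed table of the reflection in the
root `p`. -/
structure RootTable where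
  rank : ℕ
  size : ℕ
  rows : List ℕ

/-- The packed table of the `i`-th simple reflection, which permutes the positive roots other than
the `i`-th one as `perm` says. -/
def simpleRow (N : ℕ) (perm : List ℕ) (i : ℕ) : ℕ :=
  packRow ((perm.zipIdx.map fun a => bif Nat.beq a.2 i then a.1 + N else a.1) ++
    (perm.zipIdx.map fun a => bif Nat.beq a.2 i then a.1 else a.1 + N))

def conjRow (N r s : ℕ) : ℕ :=
  packRow ((List.range (2 * N)).map fun v => entry r (entry s (entry r v)))

/-- Extends the list `acc` of the rows `p - 1, …, 0` by conjugating with simple reflections. -/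
def extendRows (N : ℕ) (gens : List ℕ) : ℕ → ℕ → List ℕ → List ℕ
  | 0, _, acc => acc.reverse
  | k + 1, p, acc =>
    -- A simple reflection that lowers `p` makes row `p` a conjugate of an earlier row. Since `acc`
    -- runs down from row `p - 1`, row `q` sits at position `p - 1 - q`. The defaults are harmless:
    -- `checkRow` tests the finished table.
    let r := (gens.find? fun r => Nat.blt (entry r p) p).getD 0
    force (conjRow N r (acc.getD (p - 1 - entry r p) 0)) fun row =>
      extendRows N gens k (p + 1) (row :: acc)

/-- The rows of the root table with the given permutations of the positive roots. -/
def tableRows (N : ℕ) (perms : List (List ℕ)) : List ℕ :=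
  forceList (perms.zipIdx.map fun a => simpleRow N a.1 a.2) fun gens =>
    extendRows N gens (N - perms.length) perms.length gens.reverse

namespace RootTable

variable (D : RootTable)

def refl (p v : ℕ) : ℕ := entry (D.rows.getD p 0) v

/-- The reflection conjugate to `q` by `p`. -/
def act (p q : ℕ) : ℕ := Nat.mod (D.refl p q) D.size

/-- The order of the product of two reflections (if it is `1`, `2`, `3` or `5`). -/
def ord (p q : ℕ) : ℕ :=
  bif Nat.beq p q then 1 else bif Nat.beq (D.act p q) q then 2 else
    bif Nat.beq (D.act p q) (D.act q p) then 3 else 5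

/-- The number of edges joining two reflections in a Carter diagram. -/
def wt (p q : ℕ) : ℕ := bif Nat.beq p q then 0 else D.ord p q - 2

def coxeterFun (v : ℕ) : ℕ := (List.range D.rank).foldr D.refl v

/-- The action of the Coxeter element on the reflections. -/
def coxeterAct (q : ℕ) : ℕ := (List.range D.rank).foldr D.act q

/-- These tests make the simple rows satisfy the Coxeter relations as permutations of the roots.
Pairs with `i < j` suffice, since the relation for `(j, i)` is conjugate to the one for `(i, j)`. -/
def checkSimple (cox : List (List ℕ)) : Bool :=
  allLt D.rank fun i =>
    allLt (2 * D.size) (fun v => Nat.beq (D.refl i (D.refl i v)) v) &&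
    allLt D.rank fun j =>
      Nat.beq ((cox.getD i []).getD j 0) (D.ord i j) &&
      (Nat.ble j i || allLt (2 * D.size) fun v =>
        Nat.beq ((fun v => D.refl i (D.refl j v))^[D.ord i j] v) v)

/-- Only the fallback value 5 of `ord` needs a test of its own, since the other values are defined
by the identity they need. The last clause exhibits a non-simple reflection as a conjugate of one
with a smaller number, which allows induction on the number. -/
def checkRow (p : ℕ) : Bool :=
  allLt (2 * D.size) (fun v => Nat.blt (D.refl p v) (2 * D.size)) &&
  Nat.beq (D.refl p p) (p + D.size) &&
  allLt D.size (fun q => Nat.beq (Nat.mod (D.refl p (q + D.size)) D.size) (D.act p q) &&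
    (Nat.beq q p || !Nat.beq (D.refl p q) (q + D.size)) &&
    (!Nat.beq (D.ord p q) 5 ||
      Nat.beq (D.act p (D.act q p)) (D.act q (D.act p q)))) &&
  (Nat.blt p D.rank || (List.range D.rank).any fun i =>
    Nat.blt (D.act i p) p && allLt (2 * D.size) fun v =>
      Nat.beq (D.refl p v) (D.refl i (D.refl (D.act i p) (D.refl i v))))

end RootTable

/-! ### Enumerating factorizations -/

/-- All tables of reflections pass the test `P`. -/
def allRows (P : ℕ → ℕ → Bool) : List ℕ → ℕ → Bool
  | [], _ => true
  | r :: l, p => bif P p r then allRows P l (p + 1) else false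

namespace RootTable

variable (D : RootTable)

/-- All lists `l` of `k` reflections whose product acts as `f` are such that `P (pre ++ l)`. -/
def search (P : List ℕ → Bool) : ℕ → List ℕ → (ℕ → ℕ) → Bool
  | 0, pre, f => !allLt D.rank (fun i => Nat.beq (f i) i) || P pre
  | k + 1, pre, f =>
    -- With two factors left, `f` should be the product of reflections `p` and `q`, and then `f p f
    -- = p q p p q = p`. Testing this prunes the choice of `p` before the last loop; the root 0
    -- comes first, with `f 0` computed once.
    bif Nat.beq k 1 then
      force (f 0) fun a => allRows (fun p r => bif Nat.beq (f (entry r a)) (entry r 0) &&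
          allLt D.rank (fun i => Nat.beq (f (entry r (f i))) (entry r i)) then
        search P k (pre ++ [p]) fun v => entry r (f v) else true) D.rows 0
    else allRows (fun p r => search P k (pre ++ [p]) fun v => entry r (f v)) D.rows 0

/-- The matrix `w`, reordered by `s`, is `w'`. -/
def matchesDiagram (w w' : List (List ℕ)) (s : List ℕ) : Bool :=
  allLt D.rank fun i => allLt D.rank fun j =>
    Nat.beq ((w.getD (s.getD i 0) []).getD (s.getD j 0) 0) ((w'.getD i []).getD j 0)

/-- The Carter diagram of the reflections `t` is one of `diagrams`, up to one of the
permutations `perms`. -/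
def classified (diagrams : List (List (List ℕ))) (perms : List (List ℕ)) (t : List ℕ) : Bool :=
  forceList t fun t => forceLists (t.map fun p => t.map (D.wt p)) fun w =>
    diagrams.any fun w' => perms.any (D.matchesDiagram w w')

/-- Conjugation by powers of `c` preserves `c` and the diagram, so the first factor may be taken
from `starts` once this list meets every orbit of `c` on the reflections. The other factors then
multiply to `p c`. -/
def checkFactorizations (diagrams : List (List (List ℕ))) (starts : List ℕ) : Bool :=
  allLt D.size (fun q => (List.range D.size).any fun k =>
    starts.any (Nat.beq (D.coxeterAct^[k] q))) &&
  forceLists (List.permutations' (List.range D.rank)) fun perms => starts.all fun p =>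
    Nat.blt p D.size &&
    force (packRow ((List.range (2 * D.size)).map fun v => D.refl p (D.coxeterFun v))) fun r =>
      D.search (D.classified diagrams perms) (D.rank - 1) [p] (entry r)

end RootTable

/-! ### Relators of Carter diagrams -/

/-- The relator `(t_i (u t_b u⁻¹)) ^ m`, where `u` is a word in the generators. -/
structure Relator where
  i : ℕ
  u : List ℕ
  b : ℕ
  m : ℕ

namespace Relator

/-- The palindromic word `u t_b u⁻¹`. -/
def conjWord (r : Relator) : List ℕ := r.u ++ r.b :: r.u.reverse

def word (r : Relator) : List ℕ := (List.replicate r.m (r.i :: r.conjWord)).flatten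

/-- The word by which `r` says that `t_b` is conjugate to `t_e`, where `e = r.target`. -/
def link (r : Relator) : List ℕ :=
  r.u.reverse ++ r.i :: (bif Nat.beq r.m 2 then r.u else bif Nat.beq r.m 3 then r.conjWord else
    r.conjWord ++ r.i :: r.conjWord)

def target (r : Relator) : ℕ := bif Nat.beq r.m 2 then r.b else r.i

end Relator

/-- With at most four vertices, only cycles of length 3 and 4 occur. The second word of `(R3'')` is
replaced by its conjugate under `t_b`, so that every relator is a power of a generator times a
conjugate of a generator. `(R1)` is handled separately. -/
def relatorsOf (n : ℕ) (w : ℕ → ℕ → ℕ) : List Relator :=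
  (List.range n).flatMap fun a => (List.range n).flatMap fun b =>
    (bif Nat.beq a b then [] else [⟨a, [], b, w a b + 2⟩]) ++
    (bif Nat.beq (w a b) 0 then [] else (List.range n).flatMap fun c =>
      (bif Nat.beq (w b c) 0 then [] else
      (bif Nat.beq (w c a) 0 then (List.range n).flatMap fun d =>
        bif (Nat.beq (w b d) 0 && !Nat.beq b d && !Nat.beq a c && !Nat.beq (w c d) 0 &&
            !Nat.beq (w d a) 0 &&
            ((Nat.beq (w a b) 1 && Nat.beq (w b c) 1 && Nat.beq (w c d) 1 && Nat.beq (w d a) 1) ||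
             (Nat.beq (w d a) 3 && !(Nat.beq (w a b) 3 && Nat.beq (w b c) 3 && Nat.beq (w c d) 3))))
          then [⟨a, [b, c], d, 2⟩] else [] else
        (bif ((Nat.beq (w a b) 1 && Nat.beq (w b c) 1 && Nat.beq (w c a) 1) ||
             (Nat.beq (w c a) 3 && !(Nat.beq (w a b) 3 && Nat.beq (w b c) 3)))
          then [⟨a, [b], c, 2⟩] else []) ++
        (bif Nat.beq (w a b) 3 && Nat.beq (w b c) 3 && Nat.beq (w c a) 3 then
          [⟨a, [b], c, 3⟩, ⟨a, [b, c], b, 2⟩] else []))))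

/-! ### Coset enumeration -/

section Sweep

variable (n : ℕ) (A : ℕ → ℕ → ℕ)

/-- The edges of the word `w`, starting at `q`, are known and lead to `e`. -/
def walk (K : ℕ) : List ℕ → ℕ → ℕ → Bool
  | [], q, e => Nat.beq q e
  | i :: w, q, e => bif hasBit K (n * q + i) then walk K w (A i q) e else false

/-- Generators are involutions, so an edge is known together with its reverse. -/
def setEdge (K i q : ℕ) : ℕ := setBit (setBit K (n * q + i)) (n * A i q + i)

/-- If just one edge of the word `w` from `q` to `e` is unknown, mark it as known. -/
def deduce (e K : ℕ) : List ℕ → ℕ → ℕ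
  | [], _ => K
  | i :: w, q => bif hasBit K (n * q + i) then deduce e K w (A i q) else
      bif walk n A K w (A i q) e then setEdge n A K i q else K

/-- An edge into a new node is known for free, because it serves to define the value at that node.
The set `S` records the nodes that have a value. -/
def grow : List ℕ → ℕ → ℕ → ℕ × ℕ
  | [], S, K => (S, K)
  | e :: l, S, K =>
    bif hasBit S (e / n) && !hasBit S (A (e % n) (e / n)) then
      force (setBit S (A (e % n) (e / n))) fun S' =>
        force (setEdge n A K (e % n) (e / n)) fun K' => grow l S' K'
    else grow l S K

/-- A cyclic shift of a relator is a loop at every node; if all of its edges after the first are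
known, the first is forced. -/
def closes (rots : List (List ℕ)) (K i q : ℕ) : Bool :=
  rots.any fun w => match w with
    | [] => false
    | j :: w => Nat.beq i j && walk n A K w (A i q) q

def scan (rots : List (List ℕ)) : List ℕ → ℕ → ℕ
  | [], K => K
  | e :: l, K =>
    bif !hasBit K e && closes n A rots K (e % n) (e / n) then
      force (setEdge n A K (e % n) (e / n)) fun K' => scan rots l K'
    else scan rots l K

def deduceLinks (b : ℕ → ℕ) : List Relator → ℕ → ℕ
  | [], K => K
  | r :: l, K => force (deduce n A (b r.target) K r.link (b r.b)) fun K' => deduceLinks b l K'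

def rotations (rels : List Relator) : List (List ℕ) :=
  rels.flatMap fun r => (List.range r.word.length).map r.word.rotate

/-- The expected table `A` is given in advance, so only forced edges have to be collected. Relators
are used as loops at all nodes, and through their links as paths between the nodes of the
generators; the latter play the role of the subgroup relations in coset enumeration. -/
def sweep (b : ℕ → ℕ) (N : ℕ) (rels : List Relator) : Bool :=
  let es := List.range (n * N)
  let S := (List.range n).foldl (fun S i => setBit S (b i)) 0
  let K := (List.range n).foldl (fun K i => setBit K (n * b i + i)) 0
  -- A pass may meet an edge before its starting node has been reached, hence the second pass.
  -- Completeness is tested at the end.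
  let SK := grow n A (es ++ es) S K
  forceLists (rotations rels) fun rots =>
    let K := scan n A rots es (deduceLinks n A b rels SK.2)
    let K := scan n A rots es (deduceLinks n A b rels K)
    allLt N (hasBit SK.1) && allLt (n * N) (hasBit K)

end Sweep

def RootTable.checkDiagram (D : RootTable) (t : List ℕ) (w : List (List ℕ)) : Bool :=
  allLt D.rank (fun i => Nat.blt (t.getD i 0) D.size && allLt D.rank fun j =>
    Nat.beq (D.wt (t.getD i 0) (t.getD j 0)) ((w.getD i []).getD j 0) &&
    (Nat.beq i j || !Nat.beq (t.getD i 0) (t.getD j 0))) &&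
  forceList (t.map fun p => D.rows.getD p 0) fun gens =>
    -- The default is the row of the root 0, to agree with the default in `t.getD i 0` also for `i`
    -- out of range.
    let A : ℕ → ℕ → ℕ := fun i q => Nat.mod (entry (gens.getD i (D.rows.getD 0 0)) q) D.size
    let rels := relatorsOf D.rank fun i j => (w.getD i []).getD j 0
    rels.all (fun r =>
      Nat.beq (Nat.mod r.m (D.ord (t.getD r.i 0) (r.u.foldr A (t.getD r.b 0)))) 0) &&
      sweep D.rank A (fun i => t.getD i 0) D.size rels

/-! ### Soundness of the coset enumeration -/

section Soundness

variable {G : Type*} [Group G]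

/-- The relator `r` holds for the elements `g i`. -/
def Relator.Holds (r : Relator) (g : ℕ → G) : Prop :=
  (g r.i * ((r.u.map g).prod * g r.b * (r.u.map g).prod⁻¹)) ^ r.m = 1

/-- The letters of `r` are less than `n` and its exponent is `2`, `3` or `5`. -/
structure Relator.WellFormed (r : Relator) (n : ℕ) : Prop where
  i_lt : r.i < n
  u_lt : ∀ j ∈ r.u, j < n
  b_lt : r.b < n
  exponent : r.m = 2 ∨ r.m = 3 ∨ r.m = 5

variable {n N : ℕ} {A : ℕ → ℕ → ℕ} {b : ℕ → ℕ} {g : ℕ → G}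

theorem prod_reverse_of_involutive (hg : ∀ i < n, g i * g i = 1) {u : List ℕ}
    (hu : ∀ j ∈ u, j < n) : (u.reverse.map g).prod = (u.map g).prod⁻¹ := by
  induction u with
  | nil => simp
  | cons a u ih =>
    have ha : (g a)⁻¹ = g a := inv_eq_of_mul_eq_one_left (hg a (hu a (by simp)))
    rw [List.reverse_cons, List.map_append, List.prod_append, ih fun j hj => hu j (by simp [hj])]
    simp [ha]

theorem Relator.WellFormed.prod_conjWord {r : Relator} (hr : r.WellFormed n)
    (hg : ∀ i < n, g i * g i = 1) :
    (r.conjWord.map g).prod = (r.u.map g).prod * g r.b * (r.u.map g).prod⁻¹ := by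
  rw [Relator.conjWord, List.map_append, List.prod_append, List.map_cons, List.prod_cons,
    prod_reverse_of_involutive hg hr.u_lt, mul_assoc]

theorem Relator.WellFormed.conjWord_lt {r : Relator} (hr : r.WellFormed n) :
    ∀ j ∈ r.conjWord, j < n := by
  intro j hj
  simp only [Relator.conjWord, List.mem_append, List.mem_cons, List.mem_reverse] at hj
  rcases hj with hj | rfl | hj
  exacts [hr.u_lt j hj, hr.b_lt, hr.u_lt j hj]

theorem Relator.WellFormed.link_lt {r : Relator} (hr : r.WellFormed n) :
    ∀ j ∈ r.link, j < n := by
  have hc := hr.conjWord_lt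
  have hu := hr.u_lt
  have hi := hr.i_lt
  intro j hj
  rcases hr.exponent with h | h | h <;>
    simp only [Relator.link, h, List.mem_append, List.mem_reverse, List.mem_cons, cond_true,
      cond_false, show Nat.beq 2 2 = true from rfl, show Nat.beq 3 2 = false from rfl,
      show Nat.beq 3 3 = true from rfl, show Nat.beq 5 2 = false from rfl,
      show Nat.beq 5 3 = false from rfl] at hj <;> grind

theorem Relator.WellFormed.target_lt {r : Relator} (hr : r.WellFormed n) : r.target < n := by
  have := hr.i_lt
  have := hr.b_lt
  rw [Relator.target]
  cases Nat.beq r.m 2 <;> simpa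

theorem link_two {s H U b : G} (hs : s * s = 1) (hb : b = U⁻¹ * H * U) (h : (s * H) ^ 2 = 1)
    (hH : H * H = 1) : b = (U⁻¹ * (s * U))⁻¹ * b * (U⁻¹ * (s * U)) := by
  have hsi : s⁻¹ = s := inv_eq_of_mul_eq_one_left hs
  have hHi : H⁻¹ = H := inv_eq_of_mul_eq_one_left hH
  have h1 : s * H * s = H := by
    rw [← hHi, eq_inv_iff_mul_eq_one]
    simpa [pow_succ, mul_assoc, hHi] using h
  calc b = U⁻¹ * (s * H * s) * U := by rw [h1, hb]
    _ = U⁻¹ * (s⁻¹ * H * s) * U := by rw [hsi]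
    _ = _ := by rw [hb]; group

theorem link_three {s H U b : G} (hs : s * s = 1) (hb : b = U⁻¹ * H * U) (h : (s * H) ^ 3 = 1)
    (hH : H * H = 1) : s = (U⁻¹ * (s * H))⁻¹ * b * (U⁻¹ * (s * H)) := by
  have hsi : s⁻¹ = s := inv_eq_of_mul_eq_one_left hs
  have hHi : H⁻¹ = H := inv_eq_of_mul_eq_one_left hH
  have h1 : H * s * H * s * H = s := by
    rw [← hsi, eq_inv_iff_mul_eq_one, mul_eq_one_comm]
    simpa [pow_succ, mul_assoc, hsi] using h
  calc s = H * s * H * s * H := h1.symm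
    _ = H⁻¹ * s⁻¹ * H * s * H := by rw [hHi, hsi]
    _ = _ := by rw [hb]; group

theorem link_five {s H U b : G} (hs : s * s = 1) (hb : b = U⁻¹ * H * U) (h : (s * H) ^ 5 = 1)
    (hH : H * H = 1) :
    s = (U⁻¹ * (s * (H * (s * H))))⁻¹ * b * (U⁻¹ * (s * (H * (s * H)))) := by
  have hsi : s⁻¹ = s := inv_eq_of_mul_eq_one_left hs
  have hHi : H⁻¹ = H := inv_eq_of_mul_eq_one_left hH
  have h1 : H * s * H * s * H * s * H * s * H = s := by
    rw [← hsi, eq_inv_iff_mul_eq_one, mul_eq_one_comm]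
    simpa [pow_succ, mul_assoc, hsi] using h
  calc s = H * s * H * s * H * s * H * s * H := h1.symm
    _ = H⁻¹ * s⁻¹ * H⁻¹ * s⁻¹ * H * s * H * s * H := by rw [hHi, hsi]
    _ = _ := by rw [hb]; group

/-- Let `h = u t_b u⁻¹`. For exponent 2, `t_i` centralizes `h`, which gives a closed path at `t_b`.
For exponents 3 and 5, the involutions `t_i` and `h` generate a dihedral group in which an explicit
alternating word conjugates `h` to `t_i`. -/
theorem Relator.Holds.link_eq {r : Relator} (h : r.Holds g) (hr : r.WellFormed n)
    (hg : ∀ i < n, g i * g i = 1) :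
    g r.target = (r.link.map g).prod⁻¹ * g r.b * (r.link.map g).prod := by
  have hi := hg _ hr.i_lt
  have hc := hr.prod_conjWord hg
  have hrev := prod_reverse_of_involutive hg hr.u_lt
  have hb : g r.b = (r.u.map g).prod⁻¹ * ((r.u.map g).prod * g r.b * (r.u.map g).prod⁻¹) *
      (r.u.map g).prod := by group
  have hH : ((r.u.map g).prod * g r.b * (r.u.map g).prod⁻¹) *
      ((r.u.map g).prod * g r.b * (r.u.map g).prod⁻¹) = 1 := by
    calc _ = (r.u.map g).prod * (g r.b * g r.b) * (r.u.map g).prod⁻¹ := by group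
      _ = 1 := by rw [hg _ hr.b_lt]; group
  rw [Relator.Holds] at h
  rcases hr.exponent with hm | hm | hm <;> rw [hm] at h
  · have ht : r.target = r.b := by rw [Relator.target, hm]; rfl
    have hl : r.link = r.u.reverse ++ r.i :: r.u := by rw [Relator.link, hm]; rfl
    rw [ht, hl, List.map_append, List.prod_append, List.map_cons, List.prod_cons, hrev]
    exact link_two hi hb h hH
  · have ht : r.target = r.i := by rw [Relator.target, hm]; rfl
    have hl : r.link = r.u.reverse ++ r.i :: r.conjWord := by rw [Relator.link, hm]; rfl
    rw [ht, hl, List.map_append, List.prod_append, List.map_cons, List.prod_cons, hrev, hc]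
    exact link_three hi hb h hH
  · have ht : r.target = r.i := by rw [Relator.target, hm]; rfl
    have hl : r.link = r.u.reverse ++ r.i :: (r.conjWord ++ r.i :: r.conjWord) := by
      rw [Relator.link, hm]; rfl
    rw [ht, hl, List.map_append, List.prod_append, List.map_cons, List.prod_cons, List.map_append,
      List.prod_append, List.map_cons, List.prod_cons, hrev, hc]
    exact link_five hi hb h hH

/-- The edges marked in `K` are valid for the conjugation action of `g` on `x`. -/
def ValidEdges (n : ℕ) (A : ℕ → ℕ → ℕ) (g x : ℕ → G) (K : ℕ) : Prop :=
  ∀ i < n, ∀ q, hasBit K (n * q + i) = true → g i * x q * g i = x (A i q)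

theorem edge_inj {i j q r : ℕ} (hi : i < n) (hj : j < n) (h : n * q + i = n * r + j) :
    q = r ∧ i = j := by
  have h1 : (n * q + i) / n = q := by
    rw [Nat.mul_add_div (by omega), Nat.div_eq_of_lt hi, add_zero]
  have h2 : (n * r + j) / n = r := by
    rw [Nat.mul_add_div (by omega), Nat.div_eq_of_lt hj, add_zero]
  have h3 : q = r := by rw [← h1, h, h2]
  subst h3
  exact ⟨rfl, by omega⟩

variable {x : ℕ → G} {K : ℕ}

theorem ValidEdges.setEdge (hK : ValidEdges n A g x K) (hg : ∀ i < n, g i * g i = 1) {i q : ℕ}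
    (hi : i < n) (hq : A i (A i q) = q) (h : g i * x q * g i = x (A i q)) :
    ValidEdges n A g x (setEdge n A K i q) := by
  intro j hj r hr
  rcases hasBit_setBit hr with hr | hr
  · obtain ⟨rfl, rfl⟩ := edge_inj hj hi hr
    rw [hq, ← h]
    calc g j * (g j * x q * g j) * g j = (g j * g j) * x q * (g j * g j) := by group
      _ = x q := by rw [hg j hj]; group
  · rcases hasBit_setBit hr with hr | hr
    · obtain ⟨rfl, rfl⟩ := edge_inj hj hi hr
      exact h
    · exact hK j hj r hr

theorem ValidEdges.walk (hK : ValidEdges n A g x K) (hg : ∀ i < n, g i * g i = 1) {w : List ℕ}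
    (hw : ∀ j ∈ w, j < n) {q e : ℕ} (h : walk n A K w q e = true) :
    x e = (w.map g).prod⁻¹ * x q * (w.map g).prod := by
  induction w generalizing q with
  | nil => simp [Nat.eq_of_beq_eq_true h]
  | cons i w ih =>
    have hi : i < n := hw i (by simp)
    have hiv : (g i)⁻¹ = g i := inv_eq_of_mul_eq_one_left (hg i hi)
    rw [CarterPresentation.walk] at h
    cases hb : hasBit K (n * q + i) with
    | false => simp [hb] at h
    | true =>
      rw [hb, cond_true] at h
      rw [ih (fun j hj => hw j (by simp [hj])) h, ← hK i hi q hb]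
      simp only [List.map_cons, List.prod_cons, mul_inv_rev, hiv]
      group

/-- Following the word from `q` and going back from `e` along its known tail computes the values at
both ends of the unknown edge. -/
theorem ValidEdges.deduce (hK : ValidEdges n A g x K) (hg : ∀ i < n, g i * g i = 1)
    (hA : ∀ i < n, ∀ q < N, A i q < N ∧ A i (A i q) = q) {w : List ℕ} (hw : ∀ j ∈ w, j < n)
    {q e : ℕ} (hq : q < N) (h : x e = (w.map g).prod⁻¹ * x q * (w.map g).prod) :
    ValidEdges n A g x (deduce n A e K w q) := by
  induction w generalizing q with
  | nil => exact hK
  | cons i w ih =>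
    have hi : i < n := hw i (by simp)
    have hw' : ∀ j ∈ w, j < n := fun j hj => hw j (by simp [hj])
    have hiv : (g i)⁻¹ = g i := inv_eq_of_mul_eq_one_left (hg i hi)
    simp only [List.map_cons, List.prod_cons, mul_inv_rev, hiv] at h
    rw [CarterPresentation.deduce]
    cases hb : hasBit K (n * q + i) with
    | true =>
      refine ih hw' (hA i hi q hq).1 ?_
      rw [h, ← hK i hi q hb]
      group
    | false =>
      rw [cond_false]
      cases hwalk : CarterPresentation.walk n A K w (A i q) e with
      | false => exact hK
      | true =>
        refine hK.setEdge hg hi (hA i hi q hq).2 ?_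
        have h1 := hK.walk hg hw' hwalk
        rw [h] at h1
        have h2 := congrArg (fun y => (w.map g).prod * y * (w.map g).prod⁻¹) h1
        simp only [mul_assoc, mul_inv_cancel_left, mul_inv_cancel, mul_one] at h2
        rw [mul_assoc, h2]

theorem ValidEdges.scan (hK : ValidEdges n A g x K) (hg : ∀ i < n, g i * g i = 1)
    (hA : ∀ i < n, ∀ q < N, A i q < N ∧ A i (A i q) = q) {rots : List (List ℕ)}
    (hrots : ∀ w ∈ rots, (∀ j ∈ w, j < n) ∧ (w.map g).prod = 1) {es : List ℕ}
    (hes : ∀ e ∈ es, e < n * N) : ValidEdges n A g x (scan n A rots es K) := by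
  induction es generalizing K with
  | nil => exact hK
  | cons e es ih =>
    have hes' : ∀ e ∈ es, e < n * N := fun e he => hes e (by simp [he])
    rw [CarterPresentation.scan]
    cases hb : (!hasBit K e && closes n A rots K (e % n) (e / n)) with
    | false => exact ih hK hes'
    | true =>
      rw [cond_true, force_eq]
      refine ih ?_ hes'
      have he : e < n * N := hes e (by simp)
      have hn : 0 < n := Nat.pos_of_ne_zero (by rintro rfl; simp at he)
      have hi : e % n < n := Nat.mod_lt _ hn
      have hq : e / n < N := Nat.div_lt_of_lt_mul he
      refine hK.setEdge hg hi (hA _ hi _ hq).2 ?_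
      rw [Bool.and_eq_true] at hb
      obtain ⟨w, hw, hwalk⟩ := List.any_eq_true.1 hb.2
      obtain ⟨hlt, hprod⟩ := hrots w hw
      cases w with
      | nil => simp at hwalk
      | cons j w =>
        simp only [Bool.and_eq_true] at hwalk
        obtain ⟨hj, hwalk⟩ := hwalk
        have hj := Nat.eq_of_beq_eq_true hj
        subst hj
        have hiv : (g (e % n))⁻¹ = g (e % n) := inv_eq_of_mul_eq_one_left (hg _ hi)
        have h1 := hK.walk hg (fun j hj => hlt j (by simp [hj])) hwalk
        rw [List.map_cons, List.prod_cons] at hprod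
        -- The relator is trivial, so the remainder of the loop acts as the inverse of its first
        -- letter.
        have h2 : (w.map g).prod = g (e % n) := by rw [eq_inv_of_mul_eq_one_right hprod, hiv]
        rw [h1, h2]
        calc _ = (g (e % n) * (g (e % n))⁻¹) * x (A (e % n) (e / n)) *
              (g (e % n) * g (e % n)) := by group
          _ = _ := by rw [hg _ hi]; group

theorem ValidEdges.deduceLinks (hK : ValidEdges n A g x K) (hg : ∀ i < n, g i * g i = 1)
    (hA : ∀ i < n, ∀ q < N, A i q < N ∧ A i (A i q) = q) (hbN : ∀ i < n, b i < N)
    (hx : ∀ i < n, x (b i) = g i) {rels : List Relator}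
    (hwf : ∀ r ∈ rels, r.WellFormed n) (hrel : ∀ r ∈ rels, r.Holds g) :
    ValidEdges n A g x (deduceLinks n A b rels K) := by
  induction rels generalizing K with
  | nil => exact hK
  | cons r rels ih =>
    have hr := hwf r (by simp)
    rw [CarterPresentation.deduceLinks, force_eq]
    refine ih (hK.deduce hg hA hr.link_lt (hbN _ hr.b_lt) ?_) (fun r hr => hwf r (by simp [hr]))
      fun r hr => hrel r (by simp [hr])
    rw [hx _ hr.b_lt, hx _ hr.target_lt]
    exact (hrel r (by simp)).link_eq hr hg

theorem prod_word {r : Relator} (hr : r.WellFormed n) (hg : ∀ i < n, g i * g i = 1)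
    (h : r.Holds g) : (r.word.map g).prod = 1 := by
  rw [Relator.word, List.map_flatten, List.map_replicate, List.prod_flatten, List.map_replicate,
    List.prod_replicate, List.map_cons, List.prod_cons, hr.prod_conjWord hg]
  exact h

theorem rotations_spec {rels : List Relator} (hg : ∀ i < n, g i * g i = 1)
    (hwf : ∀ r ∈ rels, r.WellFormed n) (hrel : ∀ r ∈ rels, r.Holds g) :
    ∀ w ∈ rotations rels, (∀ j ∈ w, j < n) ∧ (w.map g).prod = 1 := by
  intro w hw
  simp only [rotations, List.mem_flatMap, List.mem_map] at hw
  obtain ⟨r, hr, k, -, rfl⟩ := hw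
  refine ⟨fun j hj => ?_, ?_⟩
  · rw [List.mem_rotate, Relator.word, List.mem_flatten] at hj
    obtain ⟨l, hl, hj⟩ := hj
    rw [List.eq_of_mem_replicate hl, List.mem_cons] at hj
    rcases hj with rfl | hj
    · exact (hwf r hr).i_lt
    · exact (hwf r hr).conjWord_lt j hj
  · rw [List.map_rotate]
    exact List.prod_rotate_eq_one_of_prod_eq_one (prod_word (hwf r hr) hg (hrel r hr)) k

/-- `x q` is obtained from some `g i` by conjugating along a path from `b i` to `q`. -/
def IsPath (n : ℕ) (A : ℕ → ℕ → ℕ) (b : ℕ → ℕ) (g : ℕ → G) (y : G) (q : ℕ) : Prop :=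
  ∃ (l : List ℕ) (i : ℕ), i < n ∧ (∀ j ∈ l, j < n) ∧ l.foldr (fun j z => g j * z * g j) (g i) = y ∧
    l.foldr A (b i) = q

/-- The values of `x` on the set `S` are paths, and the edges marked in `K` are valid. -/
structure GrowInvariant (n : ℕ) (A : ℕ → ℕ → ℕ) (b : ℕ → ℕ) (g x : ℕ → G) (S K : ℕ) : Prop where
  base : ∀ i < n, hasBit S (b i) = true ∧ x (b i) = g i
  edge : ∀ i < n, ∀ q, hasBit K (n * q + i) = true →
    hasBit S q = true ∧ hasBit S (A i q) = true ∧ g i * x q * g i = x (A i q)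
  path : ∀ q, hasBit S q = true → IsPath n A b g (x q) q

/-- Known edges have both ends in `S`, so redefining `x` at a node outside `S` does not disturb
them. -/
theorem GrowInvariant.step {S : ℕ} (h : GrowInvariant n A b g x S K)
    (hg : ∀ i < n, g i * g i = 1) {i q : ℕ} (hi : i < n) (hq : A i (A i q) = q)
    (hS : hasBit S q = true) (hS' : hasBit S (A i q) = false) :
    GrowInvariant n A b g (Function.update x (A i q) (g i * x q * g i)) (setBit S (A i q))
      (setEdge n A K i q) := by
  have hmono : ∀ {r}, hasBit S r = true → hasBit (setBit S (A i q)) r = true := fun {r} hr => by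
    rw [hasBit_eq_testBit] at hr ⊢
    change (S ||| _).testBit r = true
    rw [Nat.testBit_or, hr, Bool.true_or]
  have hnew : hasBit (setBit S (A i q)) (A i q) = true := by
    rw [hasBit_eq_testBit]
    change (S ||| 1 <<< _).testBit _ = true
    rw [Nat.testBit_or, Nat.one_shiftLeft, Nat.testBit_two_pow_self, Bool.or_true]
  have hold : ∀ {r}, hasBit S r = true →
      Function.update x (A i q) (g i * x q * g i) r = x r := fun {r} hr =>
    Function.update_of_ne (by rintro rfl; simp [hr] at hS') _ _
  refine ⟨fun j hj => ⟨hmono (h.base j hj).1, ?_⟩, fun j hj r hr => ?_, fun r hr => ?_⟩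
  · rw [hold (h.base j hj).1, (h.base j hj).2]
  · rcases hasBit_setBit hr with hr | hr
    · obtain ⟨rfl, rfl⟩ := edge_inj hj hi hr
      rw [hq]
      refine ⟨hnew, hmono hS, ?_⟩
      rw [hold hS, Function.update_self]
      calc g j * (g j * x q * g j) * g j = (g j * g j) * x q * (g j * g j) := by group
        _ = x q := by rw [hg j hj]; group
    · rcases hasBit_setBit hr with hr | hr
      · obtain ⟨rfl, rfl⟩ := edge_inj hj hi hr
        exact ⟨hmono hS, hnew, by rw [hold hS, Function.update_self]⟩
      · obtain ⟨h1, h2, h3⟩ := h.edge j hj r hr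
        exact ⟨hmono h1, hmono h2, by rw [hold h1, hold h2, h3]⟩
  · rcases hasBit_setBit hr with rfl | hr
    · obtain ⟨l, j, hj, hl, hy, he⟩ := h.path q hS
      refine ⟨i :: l, j, hj, ?_, ?_, ?_⟩
      · simpa [hi] using hl
      · rw [Function.update_self, List.foldr_cons, hy]
      · rw [List.foldr_cons, he]
    · rw [hold hr]
      exact h.path r hr

theorem GrowInvariant.grow {S : ℕ} (h : GrowInvariant n A b g x S K)
    (hg : ∀ i < n, g i * g i = 1) (hA : ∀ i < n, ∀ q < N, A i q < N ∧ A i (A i q) = q)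
    {es : List ℕ} (hes : ∀ e ∈ es, e < n * N) :
    ∃ x', GrowInvariant n A b g x' (grow n A es S K).1 (grow n A es S K).2 := by
  induction es generalizing x S K with
  | nil => exact ⟨x, h⟩
  | cons e es ih =>
    have hes' : ∀ e ∈ es, e < n * N := fun e he => hes e (by simp [he])
    rw [CarterPresentation.grow]
    cases hb : (hasBit S (e / n) && !hasBit S (A (e % n) (e / n))) with
    | false => exact ih h hes'
    | true =>
      simp only [cond_true, force_eq]
      have he : e < n * N := hes e (by simp)
      have hn : 0 < n := Nat.pos_of_ne_zero (by rintro rfl; simp at he)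
      have hi : e % n < n := Nat.mod_lt _ hn
      have hq : e / n < N := Nat.div_lt_of_lt_mul he
      simp only [Bool.and_eq_true, Bool.not_eq_true'] at hb
      exact ih (h.step hg hi (hA _ hi _ hq).2 hb.1 hb.2) hes'

theorem exists_initial (hinj : ∀ i < n, ∀ j < n, b i = b j → i = j)
    (hloop : ∀ i < n, A i (b i) = b i) (hg : ∀ i < n, g i * g i = 1) :
    ∃ x, GrowInvariant n A b g x ((List.range n).foldl (fun S i => setBit S (b i)) 0)
      ((List.range n).foldl (fun K i => setBit K (n * b i + i)) 0) := by
  classical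
  have hfold : ∀ (f : ℕ → ℕ) (l : List ℕ) (m j : ℕ),
      hasBit (l.foldl (fun S i => setBit S (f i)) m) j = true ↔
        hasBit m j = true ∨ ∃ i ∈ l, f i = j := by
    intro f l
    induction l with
    | nil => simp
    | cons a l ih =>
      intro m j
      have : hasBit (setBit m (f a)) j = true ↔ hasBit m j = true ∨ f a = j := by
        rw [hasBit_eq_testBit, hasBit_eq_testBit]
        change (m ||| 1 <<< _).testBit _ = true ↔ _
        rw [Nat.testBit_or, Nat.one_shiftLeft, Nat.testBit_two_pow]
        simp
      rw [List.foldl_cons, ih, this]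
      simp [or_assoc]
  have hx : ∀ i < n, (if h : ∃ j < n, b j = b i then g h.choose else 1) = g i := by
    intro i hi
    have h : ∃ j < n, b j = b i := ⟨i, hi, rfl⟩
    rw [dif_pos h, hinj _ h.choose_spec.1 _ hi h.choose_spec.2]
  refine ⟨fun q => if h : ∃ j < n, b j = q then g h.choose else 1, fun i hi => ⟨?_, hx i hi⟩,
    fun i hi q hq => ?_, fun q hq => ?_⟩
  · rw [hfold]
    exact .inr ⟨i, by simpa using hi, rfl⟩
  · rw [hfold (fun i => n * b i + i)] at hq
    rcases hq with hq | ⟨j, hj, hq⟩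
    · simp [hasBit_zero] at hq
    · obtain ⟨rfl, rfl⟩ := edge_inj (by simpa using hj) hi hq
      rw [hloop j hi, hfold]
      refine ⟨.inr ⟨j, hj, rfl⟩, .inr ⟨j, hj, rfl⟩, ?_⟩
      rw [hx j hi, hg j hi, one_mul]
  · rw [hfold] at hq
    rcases hq with hq | ⟨j, hj, rfl⟩
    · simp [hasBit_zero] at hq
    · exact ⟨[], j, by simpa using hj, by simp, (hx j (by simpa using hj)).symm, rfl⟩

/-- If the coset enumeration closes, then the conjugates of the generators `g i` of any group in
which the relators hold are permuted in the same way as the reflections. -/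
theorem exists_of_sweep (hA : ∀ i < n, ∀ q < N, A i q < N ∧ A i (A i q) = q)
    (hbN : ∀ i < n, b i < N) (hinj : ∀ i < n, ∀ j < n, b i = b j → i = j)
    (hloop : ∀ i < n, A i (b i) = b i) {rels : List Relator}
    (hwf : ∀ r ∈ rels, r.WellFormed n) (hs : sweep n A b N rels = true)
    (hg : ∀ i < n, g i * g i = 1) (hrel : ∀ r ∈ rels, r.Holds g) :
    ∃ x : ℕ → G, (∀ i < n, x (b i) = g i) ∧
      (∀ i < n, ∀ q < N, g i * x q * g i = x (A i q)) ∧ ∀ q < N, IsPath n A b g (x q) q := by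
  obtain ⟨x₀, h₀⟩ := exists_initial hinj hloop hg
  have hes : ∀ e ∈ List.range (n * N), e < n * N := by simp
  obtain ⟨x, hx⟩ := h₀.grow hg hA (es := List.range (n * N) ++ List.range (n * N)) (by simp)
  simp only [sweep, forceLists_eq, Bool.and_eq_true, allLt_iff] at hs
  have hrots := rotations_spec hg hwf hrel
  have hbase : ∀ i < n, x (b i) = g i := fun i hi => (hx.base i hi).2
  have hK : ValidEdges n A g x _ := fun i hi q hq => (hx.edge i hi q hq).2.2
  have hK' := (((hK.deduceLinks hg hA hbN hbase hwf hrel).scan hg hA hrots hes).deduceLinks hg hA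
    hbN hbase hwf hrel).scan hg hA hrots hes
  refine ⟨x, hbase, fun i hi q hq => hK' i hi q (hs.2 _ ?_), fun q hq => hx.path q (hs.1 q hq)⟩
  calc n * q + i < n * q + n := by omega
    _ = n * (q + 1) := by ring
    _ ≤ n * N := Nat.mul_le_mul_left _ hq

end Soundness

/-! ### The relations of a diagram with at most four vertices -/

namespace Diagram

/-- The relators `(R1)`, `(R2)`, `(R3')`, `(R3'')` hold for the elements `g i` of a group, where
`(R3')` is spelled out for cycles of length three and four. -/
structure Relations {V G : Type*} [Group G] (Γ : Diagram V) (g : V → G) : Prop where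
  mul_self : ∀ i, g i * g i = 1
  pow_eq : ∀ i j, i ≠ j → (g i * g j) ^ (Γ.weight i j + 2) = 1
  three : ∀ a b c, Γ.weight a b ≠ 0 → Γ.weight b c ≠ 0 → Γ.weight c a ≠ 0 →
    (Γ.weight a b = 1 ∧ Γ.weight b c = 1 ∧ Γ.weight c a = 1 ∨
      Γ.weight c a = 3 ∧ ¬ (Γ.weight a b = 3 ∧ Γ.weight b c = 3)) →
    (g a * g b * g c * g b) ^ 2 = 1
  four : ∀ a b c d, a ≠ c → b ≠ d → Γ.weight a c = 0 → Γ.weight b d = 0 →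
    Γ.weight a b ≠ 0 → Γ.weight b c ≠ 0 → Γ.weight c d ≠ 0 → Γ.weight d a ≠ 0 →
    (Γ.weight a b = 1 ∧ Γ.weight b c = 1 ∧ Γ.weight c d = 1 ∧ Γ.weight d a = 1 ∨
      Γ.weight d a = 3 ∧ ¬ (Γ.weight a b = 3 ∧ Γ.weight b c = 3 ∧ Γ.weight c d = 3)) →
    (g a * g b * g c * g d * g c * g b) ^ 2 = 1
  cube : ∀ a b c, Γ.weight a b = 3 → Γ.weight b c = 3 → Γ.weight c a = 3 →
    (g a * g b * g c * g b) ^ 3 = 1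
  square : ∀ a b c, Γ.weight a b = 3 → Γ.weight b c = 3 → Γ.weight c a = 3 →
    (g b * g a * g b * g c * g b * g c) ^ 2 = 1

variable {V G : Type*} [Group G] (Γ : Diagram V)

/-- The set of all relators of `Γ`. -/
abbrev relators : Set (FreeGroup V) := relR1 ∪ Γ.relR2 ∪ Γ.relR3' ∪ Γ.relR3''

variable {Γ}

theorem ne_of_weight_ne_zero {i j : V} (h : Γ.weight i j ≠ 0) : i ≠ j := by
  rintro rfl
  exact h (Γ.diag i)

theorem lift_cycleWord_three (g : V → G) (c : Fin 3 → V) :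
    FreeGroup.lift g (cycleWord c) = g (c 0) * g (c 1) * g (c 2) * g (c 1) := by
  simp [cycleWord, List.ofFn_succ, mul_assoc]

theorem lift_cycleWord_four (g : V → G) (c : Fin 4 → V) :
    FreeGroup.lift g (cycleWord c) =
      g (c 0) * g (c 1) * g (c 2) * g (c 3) * g (c 2) * g (c 1) := by
  simp [cycleWord, List.ofFn_succ, mul_assoc]

theorem isChordlessCycle_three {c : Fin 3 → V} : Γ.IsChordlessCycle c ↔
    Γ.weight (c 0) (c 1) ≠ 0 ∧ Γ.weight (c 1) (c 2) ≠ 0 ∧ Γ.weight (c 2) (c 0) ≠ 0 := by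
  constructor
  · rintro ⟨-, -, h⟩
    refine ⟨(h 0 1).2 ?_, (h 1 2).2 ?_, (h 2 0).2 ?_⟩ <;> decide
  · rintro ⟨h1, h2, h3⟩
    have h1' := Γ.symm (c 0) (c 1) ▸ h1
    have h2' := Γ.symm (c 1) (c 2) ▸ h2
    have h3' := Γ.symm (c 2) (c 0) ▸ h3
    have h (a b : Fin 3) : Γ.weight (c a) (c b) ≠ 0 ↔ a ≠ b := by
      fin_cases a <;> fin_cases b <;> simp_all [Γ.diag]
    refine ⟨le_rfl, fun a b hab => by_contra fun hne => (h a b).2 hne (hab ▸ Γ.diag _),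
      fun a b => (h a b).trans ?_⟩
    revert a b
    decide

theorem isChordlessCycle_four {c : Fin 4 → V} : Γ.IsChordlessCycle c ↔
    (c 0 ≠ c 2 ∧ c 1 ≠ c 3) ∧ (Γ.weight (c 0) (c 2) = 0 ∧ Γ.weight (c 1) (c 3) = 0) ∧
    Γ.weight (c 0) (c 1) ≠ 0 ∧ Γ.weight (c 1) (c 2) ≠ 0 ∧ Γ.weight (c 2) (c 3) ≠ 0 ∧
    Γ.weight (c 3) (c 0) ≠ 0 := by
  constructor
  · rintro ⟨-, hinj, h⟩
    refine ⟨⟨hinj.ne (by decide), hinj.ne (by decide)⟩,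
      ⟨by_contra fun h' => absurd ((h 0 2).1 h') (by decide),
        by_contra fun h' => absurd ((h 1 3).1 h') (by decide)⟩,
      (h 0 1).2 ?_, (h 1 2).2 ?_, (h 2 3).2 ?_, (h 3 0).2 ?_⟩ <;> decide
  · rintro ⟨⟨hne, hne'⟩, ⟨h02, h13⟩, h1, h2, h3, h4⟩
    have h1' := Γ.symm (c 0) (c 1) ▸ h1
    have h2' := Γ.symm (c 1) (c 2) ▸ h2
    have h3' := Γ.symm (c 2) (c 3) ▸ h3
    have h4' := Γ.symm (c 3) (c 0) ▸ h4
    have h02' := Γ.symm (c 0) (c 2) ▸ h02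
    have h13' := Γ.symm (c 1) (c 3) ▸ h13
    have h (a b : Fin 4) : Γ.weight (c a) (c b) ≠ 0 ↔ (SimpleGraph.cycleGraph 4).Adj a b := by
      fin_cases a <;> fin_cases b <;> simp_all [Γ.diag, SimpleGraph.cycleGraph_adj] <;> decide
    refine ⟨by norm_num, fun a b hab => ?_, h⟩
    have n1 := ne_of_weight_ne_zero h1
    have n2 := ne_of_weight_ne_zero h2
    have n3 := ne_of_weight_ne_zero h3
    have n4 := ne_of_weight_ne_zero h4
    fin_cases a <;> fin_cases b <;> simp_all

theorem Relations.of_lift {g : V → G} (h : ∀ r ∈ Γ.relators, FreeGroup.lift g r = 1) :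
    Γ.Relations g where
  mul_self i := by
    simpa [pow_two] using h _ (.inl (.inl (.inl ⟨i, rfl⟩)))
  pow_eq i j hij := by
    simpa using h _ (.inl (.inl (.inr ⟨i, j, hij, rfl⟩)))
  three a b c h1 h2 h3 hw := by
    have hc : Γ.IsChordlessCycle ![a, b, c] := isChordlessCycle_three.2 ⟨h1, h2, h3⟩
    have := h _ (.inl (.inr ⟨2, ![a, b, c], hc, ?_, rfl⟩))
    · rw [map_pow, lift_cycleWord_three] at this
      exact this
    · simpa [Fin.forall_fin_two, Fin.forall_fin_succ, and_assoc] using hw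
  four a b c d n1 n2 z1 z2 h1 h2 h3 h4 hw := by
    have hc : Γ.IsChordlessCycle ![a, b, c, d] :=
      isChordlessCycle_four.2 ⟨⟨n1, n2⟩, ⟨z1, z2⟩, h1, h2, h3, h4⟩
    have := h _ (.inl (.inr ⟨3, ![a, b, c, d], hc, ?_, rfl⟩))
    · rw [map_pow, lift_cycleWord_four] at this
      exact this
    · simpa [Fin.forall_fin_succ, and_assoc] using hw
  cube a b c h1 h2 h3 := by
    simpa using h _ (.inr ⟨a, b, c, h1, h2, h3, .inl rfl⟩)
  square a b c h1 h2 h3 := by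
    simpa using h _ (.inr ⟨a, b, c, h1, h2, h3, .inr rfl⟩)

theorem relations_of (Γ : Diagram V) :
    Γ.Relations (PresentedGroup.of : V → Γ.presentedGroup) :=
  Relations.of_lift fun r hr => by
    have h : FreeGroup.lift PresentedGroup.of = PresentedGroup.mk Γ.relators := by
      ext i
      simp [PresentedGroup.of]
    exact (DFunLike.congr_fun h r).trans (PresentedGroup.one_of_mem hr)

theorem Relations.lift_eq_one [Fintype V] (hV : Fintype.card V ≤ 4) {g : V → G}
    (h : Γ.Relations g) : ∀ r ∈ Γ.relators, FreeGroup.lift g r = 1 := by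
  rintro r (((⟨i, rfl⟩ | ⟨i, j, hij, rfl⟩) | ⟨d, c, hc, hw, rfl⟩) |
    ⟨a, b, c, h1, h2, h3, rfl | rfl⟩)
  · simpa [pow_two] using h.mul_self i
  · simpa using h.pow_eq i j hij
  · have hd : d + 1 ≤ 4 := by
      simpa using (Fintype.card_le_of_injective c hc.2.1).trans hV
    have hd' := hc.1
    obtain rfl | rfl : d = 2 ∨ d = 3 := by omega
    · rw [map_pow, lift_cycleWord_three]
      obtain ⟨h1, h2, h3⟩ := isChordlessCycle_three.1 hc
      refine h.three _ _ _ h1 h2 h3 ?_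
      simpa [Fin.forall_fin_succ, and_assoc] using hw
    · rw [map_pow, lift_cycleWord_four]
      obtain ⟨⟨n1, n2⟩, ⟨z1, z2⟩, h1, h2, h3, h4⟩ := isChordlessCycle_four.1 hc
      refine h.four _ _ _ _ n1 n2 z1 z2 h1 h2 h3 h4 ?_
      simpa [Fin.forall_fin_succ, and_assoc] using hw
  · simpa using h.cube a b c h1 h2 h3
  · simpa using h.square a b c h1 h2 h3

theorem Relations.comp_equiv {V' : Type*} {Γ' : Diagram V'} {g : V' → G} (h : Γ'.Relations g)
    (e : V ≃ V') (he : ∀ i j, Γ.weight i j = Γ'.weight (e i) (e j)) : Γ.Relations (g ∘ e) where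
  mul_self i := h.mul_self (e i)
  pow_eq i j hij := he i j ▸ h.pow_eq (e i) (e j) (e.injective.ne hij)
  three a b c := by simpa only [he, Function.comp] using h.three (e a) (e b) (e c)
  four a b c d n1 n2 := by
    simpa only [he, Function.comp] using
      h.four (e a) (e b) (e c) (e d) (e.injective.ne n1) (e.injective.ne n2)
  cube a b c := by simpa only [he, Function.comp] using h.cube (e a) (e b) (e c)
  square a b c := by simpa only [he, Function.comp] using h.square (e a) (e b) (e c)

end Diagram

/-! ### Relations of a diagram and the computed list of relators -/

theorem mem_cond {α : Type*} {c : Bool} {l l' : List α} {a : α} :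
    a ∈ (bif c then l else l') ↔ c = true ∧ a ∈ l ∨ c = false ∧ a ∈ l' := by
  cases c <;> simp

theorem beq_eq_true_iff {a b : ℕ} : Nat.beq a b = true ↔ a = b := by rw [Nat.beq_eq]

theorem beq_eq_false_iff {a b : ℕ} : Nat.beq a b = false ↔ a ≠ b := by
  rw [← Bool.not_eq_true, Nat.beq_eq]

theorem mem_relatorsOf {n : ℕ} {w : ℕ → ℕ → ℕ} {r : Relator} : r ∈ relatorsOf n w ↔
    ∃ a < n, ∃ b < n, (a ≠ b ∧ r = ⟨a, [], b, w a b + 2⟩) ∨ w a b ≠ 0 ∧ ∃ c < n, w b c ≠ 0 ∧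
      ((w c a = 0 ∧ ∃ d < n, (w b d = 0 ∧ b ≠ d ∧ a ≠ c ∧ w c d ≠ 0 ∧ w d a ≠ 0 ∧
          (w a b = 1 ∧ w b c = 1 ∧ w c d = 1 ∧ w d a = 1 ∨
            w d a = 3 ∧ ¬ (w a b = 3 ∧ w b c = 3 ∧ w c d = 3))) ∧ r = ⟨a, [b, c], d, 2⟩) ∨
        (w c a ≠ 0 ∧ ((w a b = 1 ∧ w b c = 1 ∧ w c a = 1 ∨
            w c a = 3 ∧ ¬ (w a b = 3 ∧ w b c = 3)) ∧ r = ⟨a, [b], c, 2⟩ ∨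
          (w a b = 3 ∧ w b c = 3 ∧ w c a = 3) ∧
            (r = ⟨a, [b], c, 3⟩ ∨ r = ⟨a, [b, c], b, 2⟩)))) := by
  simp only [relatorsOf, List.mem_flatMap, List.mem_range, List.mem_append, mem_cond,
    beq_eq_false_iff, Nat.beq_eq, Bool.and_eq_true, Bool.or_eq_true, Bool.not_eq_true',
    List.not_mem_nil, and_false, false_or, or_false, List.mem_cons, and_assoc,
    Bool.and_eq_false_iff, not_and_or, or_assoc, ne_eq]

namespace Diagram

variable {G : Type*} [Group G] {n : ℕ} {Γ : Diagram (Fin n)} {w : ℕ → ℕ → ℕ} {g : ℕ → G}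

theorem Relations.holds (h : Γ.Relations fun i => g i)
    (hw : ∀ i j : Fin n, w i j = Γ.weight i j) : ∀ r ∈ relatorsOf n w, r.Holds g := by
  have hinv : ∀ i < n, (g i)⁻¹ = g i := fun i hi =>
    inv_eq_of_mul_eq_one_left (h.mul_self ⟨i, hi⟩)
  have hw' : ∀ i (hi : i < n) j (hj : j < n), w i j = Γ.weight ⟨i, hi⟩ ⟨j, hj⟩ :=
    fun i hi j hj => hw ⟨i, hi⟩ ⟨j, hj⟩
  intro r hr
  obtain ⟨a, ha, b, hb, ⟨hne, rfl⟩ | ⟨h1, c, hc, h2, ⟨h3, d, hd, ⟨h4, n1, n2, h5, h6, h7⟩, rfl⟩ |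
    ⟨h3, ⟨h4, rfl⟩ | ⟨⟨h4, h5, h6⟩, rfl | rfl⟩⟩⟩⟩ := mem_relatorsOf.1 hr
  · rw [hw' a ha b hb]
    simpa [Relator.Holds] using h.pow_eq ⟨a, ha⟩ ⟨b, hb⟩ (by simpa using hne)
  · simp only [hw' _ ha _ hb, hw' _ hb _ hc, hw' _ hc _ hd, hw' _ hd _ ha, hw' _ hc _ ha,
      hw' _ hb _ hd] at *
    have := h.four ⟨a, ha⟩ ⟨b, hb⟩ ⟨c, hc⟩ ⟨d, hd⟩ (by simpa using n2) (by simpa using n1)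
      (by rwa [Γ.symm]) h4 h1 h2 h5 h6 h7
    simpa [Relator.Holds, hinv b hb, hinv c hc, mul_assoc] using this
  · simp only [hw' _ ha _ hb, hw' _ hb _ hc, hw' _ hc _ ha] at *
    have := h.three ⟨a, ha⟩ ⟨b, hb⟩ ⟨c, hc⟩ h1 h2 h3 h4
    simpa [Relator.Holds, hinv b hb, mul_assoc] using this
  · simp only [hw' _ ha _ hb, hw' _ hb _ hc, hw' _ hc _ ha] at *
    have := h.cube ⟨a, ha⟩ ⟨b, hb⟩ ⟨c, hc⟩ h4 h5 h6
    simpa [Relator.Holds, hinv b hb, mul_assoc] using this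
  · simp only [hw' _ ha _ hb, hw' _ hb _ hc, hw' _ hc _ ha] at *
    have := h.square ⟨a, ha⟩ ⟨b, hb⟩ ⟨c, hc⟩ h4 h5 h6
    have hbb : g b * g b = 1 := h.mul_self ⟨b, hb⟩
    simp only [Relator.Holds, List.map_cons, List.map_nil, List.prod_cons, List.prod_nil, mul_one,
      mul_inv_rev, hinv b hb, hinv c hc]
    calc (g a * (g b * g c * g b * (g c * g b))) ^ 2
        = (g b)⁻¹ * ((g b * g a * g b * g c * g b * g c) ^ 2) * g b := by
          simp only [pow_two]; group
      _ = 1 := by rw [this]; group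

theorem Relations.of_holds (hself : ∀ i < n, g i * g i = 1)
    (hw : ∀ i j : Fin n, w i j = Γ.weight i j) (h : ∀ r ∈ relatorsOf n w, r.Holds g) :
    Γ.Relations fun i => g i := by
  have hinv : ∀ i : Fin n, (g i)⁻¹ = g i := fun i => inv_eq_of_mul_eq_one_left (hself i i.2)
  refine ⟨fun i => hself i i.2, fun i j hij => ?_, fun a b c h1 h2 h3 h4 => ?_,
    fun a b c d n1 n2 z1 z2 h1 h2 h3 h4 h5 => ?_, fun a b c h1 h2 h3 => ?_,
    fun a b c h1 h2 h3 => ?_⟩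
  · have := h ⟨i, [], j, w i j + 2⟩
      (mem_relatorsOf.2 ⟨i, i.2, j, j.2, .inl ⟨by simpa [Fin.ext_iff] using hij, rfl⟩⟩)
    rw [hw] at this
    simpa [Relator.Holds] using this
  · rw [← hw] at h1 h2 h3
    rw [← hw, ← hw, ← hw] at h4
    have := h ⟨a, [b], c, 2⟩ (mem_relatorsOf.2 ⟨a, a.2, b, b.2, .inr ⟨h1, c, c.2, h2,
      .inr ⟨h3, .inl ⟨h4, rfl⟩⟩⟩⟩)
    simpa [Relator.Holds, hinv, mul_assoc] using this
  · rw [Γ.symm] at z1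
    simp only [← hw] at z1 z2 h1 h2 h3 h4 h5
    have := h ⟨a, [b, c], d, 2⟩ (mem_relatorsOf.2 ⟨a, a.2, b, b.2, .inr ⟨h1, c, c.2, h2,
      .inl ⟨z1, d, d.2, ⟨z2, by simpa [Fin.ext_iff] using n2, by simpa [Fin.ext_iff] using n1,
        h3, h4, h5⟩, rfl⟩⟩⟩)
    simpa [Relator.Holds, hinv, mul_assoc] using this
  · simp only [← hw] at h1 h2 h3
    have := h ⟨a, [b], c, 3⟩ (mem_relatorsOf.2 ⟨a, a.2, b, b.2, .inr ⟨by omega, c, c.2, by omega,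
      .inr ⟨by omega, .inr ⟨⟨h1, h2, h3⟩, .inl rfl⟩⟩⟩⟩)
    simpa [Relator.Holds, hinv, mul_assoc] using this
  · simp only [← hw] at h1 h2 h3
    have := h ⟨a, [b, c], b, 2⟩ (mem_relatorsOf.2 ⟨a, a.2, b, b.2, .inr ⟨by omega, c, c.2,
      by omega, .inr ⟨by omega, .inr ⟨⟨h1, h2, h3⟩, .inr rfl⟩⟩⟩⟩)
    simp only [Relator.Holds, List.map_cons, List.map_nil, List.prod_cons, List.prod_nil, mul_one,
      mul_inv_rev, hinv b, hinv c] at this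
    calc (g b * g a * g b * g c * g b * g c) ^ 2
        = g b * ((g a * (g b * g c * g b * (g c * g b))) ^ 2) * (g b)⁻¹ := by
          simp only [pow_two]; group
      _ = 1 := by rw [this]; group

end Diagram

theorem wellFormed_of_mem_relatorsOf {n : ℕ} {w : ℕ → ℕ → ℕ}
    (hw : ∀ i < n, ∀ j < n, w i j = 0 ∨ w i j = 1 ∨ w i j = 3) :
    ∀ r ∈ relatorsOf n w, r.WellFormed n := by
  intro r hr
  obtain ⟨a, ha, b, hb, ⟨hne, rfl⟩ | ⟨-, c, hc, -, ⟨-, d, hd, -, rfl⟩ |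
    ⟨-, ⟨-, rfl⟩ | ⟨-, rfl | rfl⟩⟩⟩⟩ := mem_relatorsOf.1 hr
  · exact ⟨ha, by simp, hb, by have := hw a ha b hb; simp only; omega⟩
  · exact ⟨ha, by simp [hb, hc], hd, .inl rfl⟩
  · exact ⟨ha, by simp [hb], hc, .inl rfl⟩
  · exact ⟨ha, by simp [hb], hc, .inr (.inl rfl)⟩
  · exact ⟨ha, by simp [hb, hc], hb, .inl rfl⟩

end CarterPresentation

namespace CarterPresentation
namespace RootTable

/-! ### Consequences of the checks -/

/-- The properties of a root table that the checks establish. -/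
structure Valid (D : RootTable) (cox : ℕ → ℕ → ℕ) : Prop where
  rank_pos : 0 < D.rank
  rank_le : D.rank ≤ D.size
  simple_simple : ∀ i < D.rank, ∀ v < 2 * D.size, D.refl i (D.refl i v) = v
  cox_eq : ∀ i < D.rank, ∀ j < D.rank, cox i j = D.ord i j
  braid : ∀ i < D.rank, ∀ j < D.rank, i < j → ∀ v < 2 * D.size,
    (fun v => D.refl i (D.refl j v))^[D.ord i j] v = v
  refl_lt : ∀ p < D.size, ∀ v < 2 * D.size, D.refl p v < 2 * D.size
  refl_self : ∀ p < D.size, D.refl p p = p + D.size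
  refl_neg : ∀ p < D.size, ∀ q < D.size, D.refl p (q + D.size) % D.size = D.act p q
  eq_of_refl : ∀ p < D.size, ∀ q < D.size, D.refl p q = q + D.size → q = p
  five : ∀ p < D.size, ∀ q < D.size, D.ord p q = 5 →
    D.act p (D.act q p) = D.act q (D.act p q)
  tree : ∀ p < D.size, D.rank ≤ p → ∃ i < D.rank, D.act i p < p ∧ ∀ v < 2 * D.size,
    D.refl p v = D.refl i (D.refl (D.act i p) (D.refl i v))

theorem Valid.of_check {D : RootTable} {cox : List (List ℕ)} (h₀ : 0 < D.rank)
    (h₁ : D.rank ≤ D.size) (h₂ : D.checkSimple cox = true) (h₃ : allLt D.size D.checkRow = true) :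
    D.Valid fun i j => (cox.getD i []).getD j 0 := by
  simp only [checkSimple, allLt_iff, Bool.and_eq_true, Nat.beq_eq, Bool.or_eq_true,
    Nat.ble_eq] at h₂
  simp only [checkRow, allLt_iff, Bool.and_eq_true, Nat.beq_eq, Bool.or_eq_true, Nat.blt_eq,
    Bool.not_eq_true', beq_eq_false_iff, List.any_eq_true, List.mem_range] at h₃
  refine ⟨h₀, h₁, fun i hi => (h₂ i hi).1, fun i hi j hj => ((h₂ i hi).2 j hj).1,
    fun i hi j hj hij => (((h₂ i hi).2 j hj).2).resolve_left (by omega),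
    fun p hp => (h₃ p hp).1.1.1, fun p hp => (h₃ p hp).1.1.2,
    fun p hp q hq => ((h₃ p hp).1.2 q hq).1.1, fun p hp q hq h => ?_, fun p hp q hq h => ?_,
    fun p hp hr => ?_⟩
  · exact ((h₃ p hp).1.2 q hq).1.2.resolve_right (by simpa using h)
  · exact ((h₃ p hp).1.2 q hq).2.resolve_left (by simpa using h)
  · exact (h₃ p hp).2.resolve_left (by omega)

namespace Valid

variable {D : RootTable} {cox : ℕ → ℕ → ℕ} (hD : D.Valid cox)
include hD

theorem size_pos : 0 < D.size := hD.rank_pos.trans_le hD.rank_le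

theorem act_lt (p q : ℕ) : D.act p q < D.size := Nat.mod_lt _ hD.size_pos

theorem refl_mod {p v : ℕ} (hp : p < D.size) (hv : v < 2 * D.size) :
    D.refl p v % D.size = D.act p (v % D.size) := by
  rcases lt_or_ge v D.size with h | h
  · rw [Nat.mod_eq_of_lt h]
    rfl
  · obtain ⟨q, rfl⟩ := Nat.exists_eq_add_of_le' h
    rw [hD.refl_neg p hp q (by omega), Nat.add_mod_right, Nat.mod_eq_of_lt (by omega)]

theorem act_self {p : ℕ} (hp : p < D.size) : D.act p p = p := by
  have : D.act p p = D.refl p p % D.size := rfl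
  rw [this, hD.refl_self p hp, Nat.add_mod_right, Nat.mod_eq_of_lt hp]

theorem simple_act_act {i q : ℕ} (hi : i < D.rank) (hq : q < D.size) :
    D.act i (D.act i q) = q := by
  have hi' := hi.trans_le hD.rank_le
  have : D.act i q = D.refl i q % D.size := rfl
  rw [this, ← hD.refl_mod hi' (hD.refl_lt i hi' q (by omega)),
    hD.simple_simple i hi q (by omega), Nat.mod_eq_of_lt hq]

end Valid

/-! ### Families of involutions permuted as in a root table -/

/-- The family `y` of involutions is permuted by conjugation in the way prescribed by `D`. -/
structure IsRep {G : Type*} [Group G] (D : RootTable) (y : ℕ → G) : Prop where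
  mul_self : ∀ q < D.size, y q * y q = 1
  conj : ∀ p < D.size, ∀ q < D.size, y p * y q * y p = y (D.act p q)

namespace IsRep

variable {D : RootTable} {cox : ℕ → ℕ → ℕ} {G : Type*} [Group G] {y : ℕ → G}

/-- Write `a`, `b` for the two involutions. If `aba = b` they commute, and `aba = bab` gives order
dividing 3. Otherwise the table guarantees `a(bab)a = b(aba)b`, which gives order dividing 5. -/
theorem pow_ord (hy : D.IsRep y) (hD : D.Valid cox) {p q : ℕ} (hp : p < D.size)
    (hq : q < D.size) : (y p * y q) ^ D.ord p q = 1 := by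
  have hpp := hy.mul_self p hp
  have hqq := hy.mul_self q hq
  have hpq := hy.conj p hp q hq
  have hqp := hy.conj q hq p hp
  have hqi : (y q)⁻¹ = y q := inv_eq_of_mul_eq_one_left hqq
  by_cases h1 : p = q
  · subst h1; simp [hpp]
  by_cases h2 : D.act p q = q
  · have : D.ord p q = 2 := by
      rw [ord, beq_eq_false_iff.2 h1, beq_eq_true_iff.2 h2]; rfl
    rw [this, pow_two, ← mul_assoc, hpq, h2, hqq]
  by_cases h3 : D.act p q = D.act q p
  · have : D.ord p q = 3 := by
      rw [ord, beq_eq_false_iff.2 h1, beq_eq_false_iff.2 h2, beq_eq_true_iff.2 h3]; rfl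
    rw [h3, ← hqp] at hpq
    rw [this]
    calc (y p * y q) ^ 3 = (y p * y q * y p) * y q * y p * y q := by
          simp only [pow_succ, pow_zero, one_mul, mul_assoc]
      _ = y q * y p * (y q * y q) * y p * y q := by rw [hpq]; group
      _ = y q * (y p * y p) * y q := by rw [hqq]; group
      _ = 1 := by rw [hpp, mul_one, hqq]
  · have h5 : D.ord p q = 5 := by
      rw [ord, beq_eq_false_iff.2 h1, beq_eq_false_iff.2 h2, beq_eq_false_iff.2 h3]; rfl
    have h := hD.five p hp q hq h5
    have e1 := hy.conj p hp _ (hD.act_lt q p)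
    have e2 := hy.conj q hq _ (hD.act_lt p q)
    rw [h, ← e2, ← hqp, ← hpq] at e1
    rw [h5]
    calc (y p * y q) ^ 5 = (y p * (y q * y p * y q) * y p) * y q * y p * y q * y p * y q := by
          simp only [pow_succ, pow_zero, one_mul, mul_assoc]
      _ = y q * y p * y q * y p * (y q * y q) * y p * y q * y p * y q := by
          rw [e1]; simp only [mul_assoc]
      _ = y q * y p * y q * (y p * y p) * y q * y p * y q := by
          rw [hqq]; simp only [mul_assoc, one_mul]
      _ = y q * y p * (y q * y q) * y p * y q := by
          rw [hpp]; simp only [mul_assoc, one_mul]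
      _ = y q * (y p * y p) * y q := by rw [hqq]; simp only [mul_assoc, one_mul]
      _ = 1 := by rw [hpp, mul_one, hqq]

/-- The value at the end of a path is determined by the values at the generators. -/
theorem foldr_conj (hy : D.IsRep y) (hD : D.Valid cox) {b : ℕ → ℕ} {n : ℕ}
    (hb : ∀ i < n, b i < D.size) {l : List ℕ} {i : ℕ} (hi : i < n) (hl : ∀ j ∈ l, j < n) :
    l.foldr (fun j z => y (b j) * z * y (b j)) (y (b i)) =
      y (l.foldr (fun j => D.act (b j)) (b i)) := by
  induction l with
  | nil => rfl
  | cons j l ih =>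
    have hlt : l.foldr (fun j => D.act (b j)) (b i) < D.size := by
      cases l with
      | nil => exact hb i hi
      | cons => exact hD.act_lt _ _
    rw [List.foldr_cons, List.foldr_cons, ih fun k hk => hl k (by simp [hk]),
      hy.conj _ (hb j (hl j (by simp))) _ hlt]

theorem prod_conj (hy : D.IsRep y) (hD : D.Valid cox) {b : ℕ → ℕ} {n : ℕ}
    (hb : ∀ i < n, b i < D.size) {l : List ℕ} {i : ℕ} (hi : i < n) (hl : ∀ j ∈ l, j < n) :
    (l.map fun j => y (b j)).prod * y (b i) * (l.map fun j => y (b j)).prod⁻¹ =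
      y (l.foldr (fun j => D.act (b j)) (b i)) := by
  rw [← hy.foldr_conj hD hb hi hl]
  induction l with
  | nil => simp
  | cons j l ih =>
    have : (y (b j))⁻¹ = y (b j) :=
      inv_eq_of_mul_eq_one_left (hy.mul_self _ (hb j (hl j (by simp))))
    rw [List.foldr_cons, ← ih fun k hk => hl k (by simp [hk]), List.map_cons, List.prod_cons,
      mul_inv_rev, this]
    group

end IsRep

end RootTable
end CarterPresentation

namespace CarterPresentation
namespace RootTable

/-! ### The reflections of a Coxeter group -/

/-- The family `x` consists of the reflections of the Coxeter group `W`, numbered as in `D`. -/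
structure Realizes (D : RootTable) {W : Type*} [Group W] {M : CoxeterMatrix (Fin D.rank)}
    (cs : CoxeterSystem M W) (x : ℕ → W) : Prop extends D.IsRep x where
  simple : ∀ i : Fin D.rank, x i = cs.simple i
  inj : ∀ p < D.size, ∀ q < D.size, x p = x q → p = q
  isReflection_iff : ∀ w, cs.IsReflection w ↔ ∃ p < D.size, x p = w
  /-- There is an action of `W` on the roots, by the rows of the table. -/
  exists_action : ∃ ρ : W →* Equiv.Perm ℕ, ∀ p < D.size, ∀ v < 2 * D.size,
    ρ (x p) v = D.refl p v

/-! ### The action on the roots and the labelling of the reflections -/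

section Action

variable {D : RootTable} {cox : ℕ → ℕ → ℕ} (hD : D.Valid cox)
  {W : Type*} [Group W] {M : CoxeterMatrix (Fin D.rank)} (cs : CoxeterSystem M W)

/-- The action of a simple reflection on the roots. -/
def simpleAction (i : Fin D.rank) : Equiv.Perm ℕ :=
  Function.Involutive.toPerm (fun v => if v < 2 * D.size then D.refl i v else v) fun v => by
    dsimp only
    by_cases hv : v < 2 * D.size
    · rw [if_pos hv, if_pos (hD.refl_lt i (i.2.trans_le hD.rank_le) v hv),
        hD.simple_simple i i.2 v hv]
    · rw [if_neg hv, if_neg hv]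

theorem simpleAction_of_lt (i : Fin D.rank) {v : ℕ} (hv : v < 2 * D.size) :
    simpleAction hD i v = D.refl i v := if_pos hv

theorem simpleAction_of_not_lt (i : Fin D.rank) {v : ℕ} (hv : ¬ v < 2 * D.size) :
    simpleAction hD i v = v := if_neg hv

theorem isLiftable_simpleAction (hM : ∀ i j : Fin D.rank, M i j = cox i j) :
    M.IsLiftable (simpleAction hD) := by
  have hlt : ∀ (i : Fin D.rank) v, v < 2 * D.size → D.refl i v < 2 * D.size := fun i v =>
    hD.refl_lt i (i.2.trans_le hD.rank_le) v
  have hself : ∀ i : Fin D.rank, simpleAction hD i * simpleAction hD i = 1 := fun i =>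
    Equiv.ext fun v => (simpleAction hD i).left_inv v
  have hbraid : ∀ i j : Fin D.rank, i < j →
      (simpleAction hD i * simpleAction hD j) ^ M i j = 1 := by
    intro i j hij
    refine Equiv.ext fun v => ?_
    rw [← Equiv.Perm.iterate_eq_pow, hM, hD.cox_eq i i.2 j j.2, Equiv.Perm.one_apply]
    by_cases hv : v < 2 * D.size
    · have key : ∀ m v, v < 2 * D.size → (simpleAction hD i * simpleAction hD j)^[m] v =
          (fun v => D.refl i (D.refl j v))^[m] v := by
        intro m
        induction m with
        | zero => exact fun _ _ => rfl
        | succ m ih =>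
          intro v hv
          rw [Function.iterate_succ_apply, Function.iterate_succ_apply, Equiv.Perm.mul_apply,
            simpleAction_of_lt hD j hv, simpleAction_of_lt hD i (hlt j v hv),
            ih _ (hlt i _ (hlt j v hv))]
      rw [key _ v hv, hD.braid i i.2 j j.2 hij v hv]
    · refine Function.iterate_fixed ?_ _
      rw [Equiv.Perm.mul_apply, simpleAction_of_not_lt hD j hv, simpleAction_of_not_lt hD i hv]
  intro i j
  rcases lt_trichotomy i j with h | rfl | h
  · exact hbraid i j h
  · rw [M.diagonal, pow_one, hself]
  · have h1 := hbraid j i h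
    rw [M.symmetric] at h1
    calc (simpleAction hD i * simpleAction hD j) ^ M i j
        = (simpleAction hD i * simpleAction hD j) ^ M i j * simpleAction hD i *
            simpleAction hD i := by
          rw [mul_assoc, hself, mul_one]
      _ = simpleAction hD i * (simpleAction hD j * simpleAction hD i) ^ M i j *
            simpleAction hD i := by
          rw [mul_pow_mul]
      _ = 1 := by rw [h1, mul_one, hself]

-- Every reflection is reached from a simple one by conjugations that lower the number, so what is
-- known for simple reflections extends by strong induction, both to conjugation and to the action
-- on the roots.
include hD in
theorem exists_realizes (hM : ∀ i j : Fin D.rank, M i j = cox i j) {x : ℕ → W}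
    (hx : ∀ i : Fin D.rank, x i = cs.simple i)
    (hconj : ∀ i < D.rank, ∀ q < D.size, x i * x q * x i = x (D.act i q)) :
    D.Realizes cs x := by
  have hsimple : ∀ i (hi : i < D.rank), x i = cs.simple ⟨i, hi⟩ := fun i hi => hx ⟨i, hi⟩
  have hss : ∀ i < D.rank, x i * x i = 1 := fun i hi => by
    rw [hsimple i hi, cs.simple_mul_simple_self]
  have htree : ∀ p < D.size, D.rank ≤ p → ∃ i < D.rank, ∃ p' < p, x p = x i * x p' * x i ∧
      ∀ v < 2 * D.size, D.refl p v = D.refl i (D.refl p' (D.refl i v)) := by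
    intro p hp hr
    obtain ⟨i, hi, hlt, h⟩ := hD.tree p hp hr
    refine ⟨i, hi, D.act i p, hlt, ?_, h⟩
    rw [hconj i hi _ (hD.act_lt _ _), hD.simple_act_act hi hp]
  have hrl : ∀ i < D.rank, i < D.size := fun i hi => hi.trans_le hD.rank_le
  have hself : ∀ p < D.size, x p * x p = 1 := by
    intro p
    induction p using Nat.strong_induction_on with
    | _ p ih =>
      intro hp
      rcases lt_or_ge p D.rank with hr | hr
      · exact hss p hr
      · obtain ⟨i, hi, p', hp', hxp, -⟩ := htree p hp hr
        rw [hxp]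
        calc x i * x p' * x i * (x i * x p' * x i)
            = x i * (x p' * ((x i * x i) * x p')) * x i := by simp only [mul_assoc]
          _ = 1 := by rw [hss i hi, one_mul, ih p' hp' (hp'.trans hp), mul_one, hss i hi]
  have hrep : D.IsRep x := by
    refine ⟨hself, fun p => ?_⟩
    induction p using Nat.strong_induction_on with
    | _ p ih =>
      intro hp q hq
      rcases lt_or_ge p D.rank with hr | hr
      · exact hconj p hr q hq
      · obtain ⟨i, hi, p', hp', hxp, hrefl⟩ := htree p hp hr
        have hact : D.act p q = D.act i (D.act p' (D.act i q)) := by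
          have h1 : D.refl i q < 2 * D.size := hD.refl_lt i (hrl i hi) q (by omega)
          have h2 := hD.refl_lt p' (hp'.trans hp) _ h1
          change D.refl p q % D.size = _
          rw [hrefl q (by omega), hD.refl_mod (hrl i hi) h2, hD.refl_mod (hp'.trans hp) h1]
          rfl
        rw [hact, ← hconj i hi _ (hD.act_lt _ _), ← ih p' hp' (hp'.trans hp) _ (hD.act_lt _ _),
          ← hconj i hi q hq, hxp]
        simp only [mul_assoc]
  let ρ := cs.lift ⟨simpleAction hD, isLiftable_simpleAction hD hM⟩
  have hρs : ∀ i (hi : i < D.rank), ∀ v < 2 * D.size, ρ (x i) v = D.refl i v := by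
    intro i hi v hv
    rw [hsimple i hi, cs.lift_apply_simple]
    exact simpleAction_of_lt hD _ hv
  have hρ : ∀ p < D.size, ∀ v < 2 * D.size, ρ (x p) v = D.refl p v := by
    intro p
    induction p using Nat.strong_induction_on with
    | _ p ih =>
      intro hp v hv
      rcases lt_or_ge p D.rank with hr | hr
      · exact hρs p hr v hv
      · obtain ⟨i, hi, p', hp', hxp, hrefl⟩ := htree p hp hr
        have h1 := hD.refl_lt i (hrl i hi) v hv
        have h2 := hD.refl_lt p' (hp'.trans hp) _ h1
        rw [hrefl v hv, hxp, map_mul, map_mul]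
        change ρ (x i) (ρ (x p') (ρ (x i) v)) = _
        rw [hρs i hi v hv, ih p' hp' (hp'.trans hp) _ h1, hρs i hi _ h2]
  refine ⟨hrep, hx, fun p hp q hq h => ?_, fun w => ⟨?_, ?_⟩, ρ, hρ⟩
  -- The reflection `x p` sends the root `p` to its negative, and by the table no other reflection
  -- does.
  · have h1 := hρ p hp p (by omega)
    rw [h, hρ q hq p (by omega), hD.refl_self p hp] at h1
    exact hD.eq_of_refl q hq p hp h1
  · rintro ⟨w, i, rfl⟩
    induction w using cs.simple_induction_left with
    | one => exact ⟨i, hrl i i.2, by simp [hx]⟩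
    | mul_simple_left w j ih =>
      obtain ⟨p, hp, h⟩ := ih
      refine ⟨D.act j p, hD.act_lt _ _, ?_⟩
      rw [← hconj j j.2 p hp, h, hx, mul_inv_rev, cs.inv_simple]
      simp only [mul_assoc]
  · rintro ⟨p, hp, rfl⟩
    induction p using Nat.strong_induction_on with
    | _ p ih =>
      rcases lt_or_ge p D.rank with hr | hr
      · rw [hsimple p hr]
        exact cs.isReflection_simple _
      · obtain ⟨i, hi, p', hp', hxp, -⟩ := htree p hp hr
        have := (ih p' hp' (hp'.trans hp)).conj (cs.simple ⟨i, hi⟩)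
        rwa [cs.inv_simple, ← hsimple i hi, ← hxp] at this

namespace Realizes

variable {cs} {x : ℕ → W} (hx : D.Realizes cs x)
include hD hx

theorem act_act {p q : ℕ} (hp : p < D.size) (hq : q < D.size) : D.act p (D.act p q) = q := by
  refine hx.inj _ (hD.act_lt _ _) _ hq ?_
  have hpp := hx.mul_self p hp
  rw [← hx.conj p hp _ (hD.act_lt _ _), ← hx.conj p hp q hq]
  calc x p * (x p * x q * x p) * x p = (x p * x p) * x q * (x p * x p) := by
        simp only [mul_assoc]
    _ = x q := by rw [hpp, one_mul, mul_one]

/-- Both sides label the same conjugate in `W`; injectivity of the labelling spares a check over all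
triples. -/
theorem act_act_act {r p q : ℕ} (hr : r < D.size) (hp : p < D.size) (hq : q < D.size) :
    D.act (D.act r p) q = D.act r (D.act p (D.act r q)) := by
  refine hx.inj _ (hD.act_lt _ _) _ (hD.act_lt _ _) ?_
  rw [← hx.conj _ (hD.act_lt _ _) q hq, ← hx.conj r hr _ (hD.act_lt _ _),
    ← hx.conj p hp _ (hD.act_lt _ _), ← hx.conj r hr q hq, ← hx.conj r hr p hp]
  simp only [mul_assoc]

/-- For distinct labels the product is nontrivial and its order divides one of the primes 2, 3, 5.
-/
theorem orderOf_mul {p q : ℕ} (hp : p < D.size) (hq : q < D.size) :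
    orderOf (x p * x q) = D.ord p q := by
  have h := hx.pow_ord hD hp hq
  by_cases hpq : p = q
  · subst hpq
    rw [hx.mul_self p hp, orderOf_one, ord, beq_eq_true_iff.2 rfl]
    rfl
  have hne : x p * x q ≠ 1 := by
    intro h1
    refine hpq (hx.inj p hp q hq ?_)
    rw [eq_inv_of_mul_eq_one_left h1, inv_eq_of_mul_eq_one_left (hx.mul_self q hq)]
  have hprime : (D.ord p q).Prime := by
    rw [ord, beq_eq_false_iff.2 hpq]
    cases Nat.beq (D.act p q) q <;> cases Nat.beq (D.act p q) (D.act q p) <;> norm_num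
  have := Fact.mk hprime
  exact orderOf_eq_prime h hne

theorem carterDiagram_weight {k : ℕ} {t : Fin k → W} {p : Fin k → ℕ} (hp : ∀ i, p i < D.size)
    (ht : ∀ i, x (p i) = t i) (i j : Fin k) :
    (carterDiagram t).weight i j = D.wt (p i) (p j) := by
  change (if i = j then 0 else orderOf (t i * t j) - 2) = _
  rw [← ht, ← ht, hx.orderOf_mul hD (hp i) (hp j), wt]
  by_cases hij : i = j
  · subst hij
    rw [if_pos rfl, beq_eq_true_iff.2 rfl]
    rfl
  · rw [if_neg hij]
    cases h : Nat.beq (p i) (p j)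
    · rfl
    · rw [ord, h]
      rfl

end Realizes

end Action

end RootTable
end CarterPresentation

namespace CarterPresentation
namespace RootTable

/-! ### Isomorphisms -/

theorem wt_mem (D : RootTable) (p q : ℕ) : D.wt p q = 0 ∨ D.wt p q = 1 ∨ D.wt p q = 3 := by
  rw [wt, ord]
  cases Nat.beq p q <;> cases Nat.beq (D.act p q) q <;>
    cases Nat.beq (D.act p q) (D.act q p) <;> simp

theorem ord_eq_wt_add_two (D : RootTable) {p q : ℕ} (h : p ≠ q) : D.ord p q = D.wt p q + 2 := by
  rw [wt, ord, beq_eq_false_iff.2 h]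
  cases Nat.beq (D.act p q) q <;> cases Nat.beq (D.act p q) (D.act q p) <;> rfl

/-- The reflections `b i` for `i < D.rank` have the diagram `w`, and both the relators of the
diagram and the coset enumeration are consistent with the table. -/
structure Generates (D : RootTable) (b : ℕ → ℕ) (w : ℕ → ℕ → ℕ) : Prop where
  lt : ∀ i < D.rank, b i < D.size
  wt_eq : ∀ i < D.rank, ∀ j < D.rank, D.wt (b i) (b j) = w i j
  inj : ∀ i < D.rank, ∀ j < D.rank, b i = b j → i = j
  ord_dvd : ∀ r ∈ relatorsOf D.rank w,
    D.ord (b r.i) (r.u.foldr (fun i => D.act (b i)) (b r.b)) ∣ r.m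
  sweep_eq : sweep D.rank (fun i => D.act (b i)) b D.size (relatorsOf D.rank w) = true

theorem generates_of_check {D : RootTable} {t : List ℕ} {w : List (List ℕ)}
    (h : D.checkDiagram t w = true) :
    D.Generates (fun i => t.getD i 0) fun i j => (w.getD i []).getD j 0 := by
  have hA : (fun i q => Nat.mod (entry ((t.map fun p => D.rows.getD p 0).getD i
      (D.rows.getD 0 0)) q) D.size) = fun i => D.act (t.getD i 0) := by
    funext i q
    rw [List.getD_map (f := fun p => D.rows.getD p 0)]
    rfl
  rw [checkDiagram, forceList_eq, hA] at h
  simp only [allLt_iff, Bool.and_eq_true, Nat.beq_eq, Bool.or_eq_true, Nat.blt_eq,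
    Bool.not_eq_true', beq_eq_false_iff, List.all_eq_true] at h
  obtain ⟨h1, h2, h3⟩ := h
  exact ⟨fun i hi => (h1 i hi).1, fun i hi j hj => ((h1 i hi).2 j hj).1,
    fun i hi j hj hij => ((h1 i hi).2 j hj).2.resolve_right fun hne => hne hij,
    fun r hr => Nat.dvd_of_mod_eq_zero (h2 r hr), h3⟩

namespace Generates

variable {D : RootTable} {b : ℕ → ℕ} {w : ℕ → ℕ → ℕ} (hb : D.Generates b w)
  {cox : ℕ → ℕ → ℕ} (hD : D.Valid cox)
include hb

theorem wellFormed : ∀ r ∈ relatorsOf D.rank w, r.WellFormed D.rank :=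
  wellFormed_of_mem_relatorsOf fun i hi j hj => hb.wt_eq i hi j hj ▸ D.wt_mem _ _

include hD

theorem exists_reflections {G : Type*} [Group G]
    (hinv : ∀ i < D.rank, ∀ q < D.size, D.act (b i) (D.act (b i) q) = q) {g : ℕ → G}
    (hg : ∀ i < D.rank, g i * g i = 1) (hrel : ∀ r ∈ relatorsOf D.rank w, r.Holds g) :
    ∃ y : ℕ → G, (∀ i < D.rank, y (b i) = g i) ∧
      (∀ i < D.rank, ∀ q < D.size, g i * y q * g i = y (D.act (b i) q)) ∧
      ∀ q < D.size, IsPath D.rank (fun i => D.act (b i)) b g (y q) q :=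
  exists_of_sweep (fun i hi q hq => ⟨hD.act_lt _ _, hinv i hi q hq⟩) hb.lt hb.inj
    (fun i hi => hD.act_self (hb.lt i hi)) hb.wellFormed hb.sweep_eq hg hrel

/-- Each relator is a power of a product of two members of the family, the second found by following
`u` in the table, so `pow_ord` and the divisibility check suffice. -/
theorem relations {G : Type*} [Group G] {x : ℕ → G} (hx : D.IsRep x)
    {Γ : Diagram (Fin D.rank)} (hw : ∀ i j : Fin D.rank, w i j = Γ.weight i j) :
    Γ.Relations fun i => x (b i) := by
  refine Diagram.Relations.of_holds (g := fun i => x (b i)) (w := w)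
    (fun i hi => hx.mul_self _ (hb.lt i hi)) hw fun r hr => ?_
  have hwf := hb.wellFormed r hr
  rw [Relator.Holds, hx.prod_conj hD hb.lt hwf.b_lt hwf.u_lt]
  obtain ⟨m, hm⟩ := hb.ord_dvd r hr
  have hlt : r.u.foldr (fun i => D.act (b i)) (b r.b) < D.size := by
    cases r.u with
    | nil => exact hb.lt _ hwf.b_lt
    | cons => exact hD.act_lt _ _
  rw [hm, pow_mul, hx.pow_ord hD (hb.lt _ hwf.i_lt) hlt, one_pow]

end Generates

/-- The enumeration is applied inside `W` to the simple reflections. The hypothesis `hu` excludes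
cycle relators, so only Coxeter relations have to be supplied. -/
theorem Valid.exists_realizes {D : RootTable} {cox : ℕ → ℕ → ℕ} (hD : D.Valid cox) {W : Type*}
    [Group W] {M : CoxeterMatrix (Fin D.rank)} (cs : CoxeterSystem M W)
    (hM : ∀ i j : Fin D.rank, M i j = cox i j) {b : ℕ → ℕ} {w : ℕ → ℕ → ℕ}
    (hb : D.Generates b w) (hb_eq : ∀ i < D.rank, b i = i)
    (hu : (relatorsOf D.rank w).all fun r => r.u.isEmpty) :
    ∃ x, D.Realizes cs x := by
  let g : ℕ → W := fun i => if h : i < D.rank then cs.simple ⟨i, h⟩ else 1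
  have hg : ∀ i (h : i < D.rank), g i = cs.simple ⟨i, h⟩ := fun i h => dif_pos h
  obtain ⟨x, hx, hconj, -⟩ := hb.exists_reflections hD (g := g) (fun i hi q hq => by
      rw [hb_eq i hi, hD.simple_act_act hi hq])
    (fun i hi => by rw [hg i hi, cs.simple_mul_simple_self]) (fun r hr => by
      have hnil : r.u = [] := by simpa using List.all_eq_true.1 hu r hr
      obtain ⟨a, ha, c, hc, ⟨hne, rfl⟩ | ⟨-, d, -, -, ⟨-, e, -, -, rfl⟩ |
        ⟨-, ⟨-, rfl⟩ | ⟨-, rfl | rfl⟩⟩⟩⟩ := mem_relatorsOf.1 hr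
      · have h := cs.simple_mul_simple_pow ⟨a, ha⟩ ⟨c, hc⟩
        rw [hM, hD.cox_eq a ha c hc, D.ord_eq_wt_add_two hne] at h
        rw [← hb.wt_eq a ha c hc, hb_eq a ha, hb_eq c hc]
        simpa [Relator.Holds, hg a ha, hg c hc] using h
      all_goals simp at hnil)
  refine ⟨x, RootTable.exists_realizes hD cs hM (fun i => ?_) fun i hi q hq => ?_⟩
  · rw [← hg i i.2, ← hx i i.2, hb_eq i i.2]
  · have h := hconj i hi q hq
    rwa [← hx i hi, hb_eq i hi] at h

namespace Realizes

variable {D : RootTable} {cox : ℕ → ℕ → ℕ} (hD : D.Valid cox) {W : Type*} [Group W]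
  {M : CoxeterMatrix (Fin D.rank)} {cs : CoxeterSystem M W} {x : ℕ → W}
  {b : ℕ → ℕ} {w : ℕ → ℕ → ℕ}
include hD

/-- Induction along a path: conjugation by `g j * z * g j` is the composite of three known
permutations, and `act_act_act` identifies it with the reflection in the image root. -/
theorem isRep_of_isPath (hx : D.Realizes cs x) (hb : D.Generates b w) {G : Type*} [Group G]
    {g y : ℕ → G} (hg : ∀ i < D.rank, g i * g i = 1)
    (hconj : ∀ i < D.rank, ∀ q < D.size, g i * y q * g i = y (D.act (b i) q))
    (hpath : ∀ q < D.size, IsPath D.rank (fun i => D.act (b i)) b g (y q) q) : D.IsRep y := by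
  have key : ∀ l : List ℕ, (∀ j ∈ l, j < D.rank) → ∀ i < D.rank,
      l.foldr (fun i => D.act (b i)) (b i) < D.size ∧
      l.foldr (fun j z => g j * z * g j) (g i) * l.foldr (fun j z => g j * z * g j) (g i) = 1 ∧
      ∀ q < D.size, l.foldr (fun j z => g j * z * g j) (g i) * y q *
        l.foldr (fun j z => g j * z * g j) (g i) =
          y (D.act (l.foldr (fun i => D.act (b i)) (b i)) q) := by
    intro l hl i hi
    induction l with
    | nil => exact ⟨hb.lt i hi, hg i hi, hconj i hi⟩
    | cons j l ih =>
      obtain ⟨h1, h2, h3⟩ := ih fun k hk => hl k (by simp [hk])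
      have hj := hl j (by simp)
      simp only [List.foldr_cons]
      generalize l.foldr (fun j z => g j * z * g j) (g i) = z at *
      refine ⟨hD.act_lt _ _, ?_, fun q hq => ?_⟩
      · calc g j * z * g j * (g j * z * g j) = g j * z * (g j * g j) * z * g j := by
              simp only [mul_assoc]
          _ = g j * (z * z) * g j := by rw [hg j hj]; simp only [mul_assoc, one_mul]
          _ = 1 := by rw [h2, mul_one, hg j hj]
      · rw [hx.act_act_act hD (hb.lt j hj) h1 hq, ← hconj j hj _ (hD.act_lt _ _),
          ← h3 _ (hD.act_lt _ _), ← hconj j hj q hq]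
        simp only [mul_assoc]
  refine ⟨fun q hq => ?_, fun p hp q hq => ?_⟩
  · obtain ⟨l, i, hi, hl, h1, h2⟩ := hpath q hq
    rw [← h1]
    exact (key l hl i hi).2.1
  · obtain ⟨l, i, hi, hl, h1, h2⟩ := hpath p hp
    have := (key l hl i hi).2.2 q hq
    rwa [h1, h2] at this

/-- The family `y` in `W(Γ)` and the reflections `x` in `W` are indexed by the same roots; both
homomorphisms respect this indexing, so they are inverse on generators. -/
theorem nonempty_mulEquiv (hx : D.Realizes cs x) (hM : ∀ i j : Fin D.rank, M i j = cox i j)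
    (hrank : D.rank ≤ 4) (hb : D.Generates b w) {Γ : Diagram (Fin D.rank)}
    (σ : Equiv.Perm (Fin D.rank)) (hσ : ∀ i j, Γ.weight (σ i) (σ j) = w i j) :
    Nonempty (Γ.presentedGroup ≃* W) := by
  let Γ' : Diagram (Fin D.rank) :=
    ⟨fun i j => Γ.weight (σ i) (σ j), fun i j => Γ.symm _ _, fun i => Γ.diag _⟩
  let P := Γ.presentedGroup
  let of : Fin D.rank → P := PresentedGroup.of
  have hof : Γ.Relations of := Γ.relations_of
  let g : ℕ → P := fun i => if h : i < D.rank then of (σ ⟨i, h⟩) else 1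
  have hg : ∀ i (h : i < D.rank), g i = of (σ ⟨i, h⟩) := fun i h => dif_pos h
  have hgrel : Γ'.Relations fun i => g i := by
    have h : (fun i : Fin D.rank => g i) = of ∘ σ := funext fun i => hg i i.2
    rw [h]
    exact hof.comp_equiv σ fun i j => rfl
  have hgg : ∀ i < D.rank, g i * g i = 1 := fun i hi => hgrel.mul_self ⟨i, hi⟩
  obtain ⟨y, hy, hconj, hpath⟩ := hb.exists_reflections hD
    (fun i hi q hq => hx.act_act hD (hb.lt i hi) hq) hgg
    (hgrel.holds fun i j => (hσ i j).symm)
  have hrep := hx.isRep_of_isPath hD hb hgg hconj hpath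
  have hxrel : Γ.Relations ((fun i : Fin D.rank => x (b i)) ∘ σ.symm) :=
    (hb.relations hD hx.toIsRep (Γ := Γ') fun i j => (hσ i j).symm).comp_equiv σ.symm
      fun i j => by simp [Γ']
  let α : P →* W := PresentedGroup.toGroup (hxrel.lift_eq_one (by simpa using hrank))
  have hα : ∀ i (hi : i < D.rank), α (g i) = x (b i) := by
    intro i hi
    rw [hg i hi]
    refine (PresentedGroup.toGroup.of _).trans ?_
    simp
  have hlt : ∀ i : Fin D.rank, (i : ℕ) < D.size := fun i => i.2.trans_le hD.rank_le
  -- Here `i` is a simple root and not a vertex of the diagram; the vertices sit at the roots `b i`.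
  let β : W →* P := cs.lift ⟨fun i => y i, fun i j => by
    rw [hM, hD.cox_eq i i.2 j j.2]
    exact hrep.pow_ord hD (hlt i) (hlt j)⟩
  have hβs : ∀ i (hi : i < D.rank), β (x i) = y i := fun i hi => by
    rw [show x i = cs.simple ⟨i, hi⟩ from hx.simple ⟨i, hi⟩]
    exact cs.lift_apply_simple _ _
  have hβ : ∀ q < D.size, β (x q) = y q := by
    intro q
    induction q using Nat.strong_induction_on with
    | _ q ih =>
      intro hq
      rcases lt_or_ge q D.rank with hr | hr
      · exact hβs q hr
      · obtain ⟨i, hi, hlt', -⟩ := hD.tree q hq hr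
        have hi' := hlt ⟨i, hi⟩
        have e : D.act i (D.act i q) = q := hD.simple_act_act hi hq
        rw [← e, ← hx.conj i hi' _ (hD.act_lt _ _), ← hrep.conj i hi' _ (hD.act_lt _ _),
          map_mul, map_mul, hβs i hi, ih _ hlt' (hD.act_lt _ _)]
  have hαy : ∀ q < D.size, α (y q) = x q := by
    intro q hq
    obtain ⟨l, i, hi, hl, h1, h2⟩ := hpath q hq
    rw [← h1, ← h2, ← hx.foldr_conj hD hb.lt hi hl]
    clear h1 h2
    induction l with
    | nil => exact hα i hi
    | cons j l ih =>
      rw [List.foldr_cons, List.foldr_cons, map_mul, map_mul, hα j (hl j (by simp)),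
        ih fun k hk => hl k (by simp [hk])]
  refine ⟨α.toMulEquiv β ?_ ?_⟩
  · refine PresentedGroup.ext fun j => ?_
    have h1 : g (σ.symm j) = PresentedGroup.of j := by
      rw [hg _ (σ.symm j).2]
      simp [of]
    rw [MonoidHom.comp_apply, ← h1, hα _ (σ.symm j).2, hβ _ (hb.lt _ (σ.symm j).2),
      hy _ (σ.symm j).2]
    rfl
  · refine cs.ext_simple fun i => ?_
    rw [MonoidHom.comp_apply, ← hx.simple, hβs i i.2, hαy i (hlt i)]
    rfl

end Realizes

end RootTable
-- Soundness of the search for factorizations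
theorem entry_packRow {l : List ℕ} (hl : ∀ a ∈ l, a < 128) (v : ℕ) :
    entry (packRow l) v = l.getD v 0 := by
  have hentry : ∀ t v, entry t v = t / 128 ^ v % 128 := fun t v => by
    change t >>> (7 * v) &&& (2 ^ 7 - 1) = _
    rw [Nat.and_two_pow_sub_one_eq_mod, Nat.shiftRight_eq_div_pow, pow_mul]
    rfl
  rw [hentry]
  induction l generalizing v with
  | nil => simp [packRow]
  | cons a l ih =>
    have ha := hl a (by simp)
    have hpack : packRow (a :: l) = a + 128 * packRow l := rfl
    cases v with
    | zero => rw [hpack, pow_zero, Nat.div_one, List.getD_cons_zero]; omega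
    | succ v =>
      rw [hpack, List.getD_cons_succ, ← ih (fun b hb => hl b (by simp [hb])) v, pow_succ',
        ← Nat.div_div_eq_div_mul, Nat.add_mul_div_left _ _ (by norm_num), Nat.div_eq_of_lt ha,
        zero_add]

theorem allRows_spec {P : ℕ → ℕ → Bool} {l : List ℕ} {p : ℕ} (h : allRows P l p = true) :
    ∀ i < l.length, P (p + i) (l.getD i 0) = true := by
  induction l generalizing p with
  | nil => simp
  | cons a l ih =>
    rw [allRows] at h
    cases ha : P p a with
    | false => simp [ha] at h
    | true =>
      rw [ha, cond_true] at h
      intro i hi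
      cases i with
      | zero => simpa using ha
      | succ i =>
        have := ih h i (by simpa using hi)
        rwa [add_assoc, add_comm 1 i] at this

namespace RootTable

variable {D : RootTable} {cox : ℕ → ℕ → ℕ}

section

variable (hD : D.Valid cox)
include hD

theorem Valid.foldr_refl_lt {l : List ℕ} (hl : ∀ p ∈ l, p < D.size) {v : ℕ}
    (hv : v < 2 * D.size) : l.foldr D.refl v < 2 * D.size := by
  induction l with
  | nil => exact hv
  | cons p l ih =>
    exact hD.refl_lt p (hl p (by simp)) _ (ih fun q hq => hl q (by simp [hq]))

theorem Valid.coxeterFun_lt {v : ℕ} (hv : v < 2 * D.size) : D.coxeterFun v < 2 * D.size :=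
  hD.foldr_refl_lt (fun _ hp => (List.mem_range.1 hp).trans_le hD.rank_le) hv

theorem search_sound (hself : ∀ p < D.size, ∀ v < 2 * D.size, D.refl p (D.refl p v) = v)
    (hlen : D.rows.length = D.size) {P : List ℕ → Bool} {k : ℕ} {pre : List ℕ} {f : ℕ → ℕ}
    (h : D.search P k pre f = true) {l : List ℕ} (hk : l.length = k) (hl : ∀ p ∈ l, p < D.size)
    (hf : ∀ v < 2 * D.size, f v = l.foldr D.refl v) : P (pre ++ l) = true := by
  have hr : ∀ i < D.rank, i < 2 * D.size := fun i hi => by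
    have := hD.rank_le
    omega
  induction k generalizing pre f l with
  | zero =>
    obtain rfl := List.length_eq_zero_iff.1 hk
    rw [search, Bool.or_eq_true, Bool.not_eq_true'] at h
    rw [List.append_nil]
    refine h.resolve_left fun h' => ?_
    rw [← Bool.not_eq_true, allLt_iff] at h'
    exact h' fun i hi => beq_eq_true_iff.2 (hf i (hr i hi))
  | succ k ih =>
    cases l with
    | nil => simp at hk
    | cons p l =>
      have hp := hl p (by simp)
      have hl' : ∀ q ∈ l, q < D.size := fun q hq => hl q (by simp [hq])
      have hf' : ∀ v < 2 * D.size, D.refl p (f v) = l.foldr D.refl v := fun v hv => by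
        rw [hf v hv, List.foldr_cons, hself p hp _ (hD.foldr_refl_lt hl' hv)]
      have key : D.search P k (pre ++ [p]) (fun v => D.refl p (f v)) = true →
          P (pre ++ p :: l) = true := fun h => by
        simpa using ih h (by simpa using hk) hl' hf'
      rw [search] at h
      cases hk1 : Nat.beq k 1 with
      | false =>
        rw [hk1, cond_false] at h
        have := allRows_spec h p (by omega)
        rw [zero_add] at this
        exact key this
      | true =>
        rw [hk1, cond_true, force_eq] at h
        have h' := allRows_spec h p (by omega)
        rw [zero_add] at h'
        obtain rfl : k = 1 := by simpa using hk1
        obtain ⟨q, rfl⟩ := List.length_eq_one_iff.1 (show l.length = 1 by simpa using hk)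
        have hq := hl' q (by simp)
        -- The pruning test never rejects a true factorization: `f = p q` implies `f p f = p`.
        have hf2 : ∀ i < D.rank, f (D.refl p (f i)) = D.refl p i := fun i hi => by
          rw [hf' i (hr i hi)]
          change f (D.refl q i) = _
          rw [hf _ (hD.refl_lt q hq i (hr i hi))]
          change D.refl p (D.refl q (D.refl q i)) = _
          rw [hself q hq i (hr i hi)]
        have hc : (Nat.beq (f (entry (D.rows.getD p 0) (f 0))) (entry (D.rows.getD p 0) 0) &&
            allLt D.rank fun i => Nat.beq (f (entry (D.rows.getD p 0) (f i)))
              (entry (D.rows.getD p 0) i)) = true := by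
          rw [Bool.and_eq_true, allLt_iff]
          exact ⟨beq_eq_true_iff.2 (hf2 0 hD.rank_pos), fun i hi => beq_eq_true_iff.2 (hf2 i hi)⟩
        rw [hc, cond_true] at h'
        exact key h'

end

theorem exists_perm_of_classified {diagrams : List (List (List ℕ))} {t : List ℕ}
    (ht : t.length = D.rank)
    (h : D.classified diagrams (List.permutations' (List.range D.rank)) t = true) :
    ∃ w ∈ diagrams, ∃ σ : Equiv.Perm (Fin D.rank), ∀ i j : Fin D.rank,
      D.wt (t.getD (σ i) 0) (t.getD (σ j) 0) = (w.getD i []).getD j 0 := by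
  rw [classified, forceList_eq, forceLists_eq] at h
  simp only [List.any_eq_true, List.mem_permutations'] at h
  obtain ⟨w, hw, s, hs, h⟩ := h
  simp only [matchesDiagram, allLt_iff, Nat.beq_eq] at h
  have hlen : s.length = D.rank := by simpa using hs.length_eq
  have hget : ∀ i (hi : i < D.rank), s.getD i 0 = s[i]'(hlen ▸ hi) := fun i hi =>
    List.getD_eq_getElem _ _ _
  have hlt : ∀ i (hi : i < D.rank), s.getD i 0 < D.rank := fun i hi => by
    rw [hget i hi, ← List.mem_range, ← hs.mem_iff]
    exact List.getElem_mem _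
  have hnd : s.Nodup := hs.nodup_iff.2 List.nodup_range
  let f : Fin D.rank → Fin D.rank := fun i => ⟨s.getD i 0, hlt i i.2⟩
  have hf : Function.Injective f := fun i j hij => by
    have : s.getD i 0 = s.getD j 0 := congrArg Fin.val hij
    rw [hget i i.2, hget j j.2, hnd.getElem_inj_iff] at this
    exact Fin.ext this
  refine ⟨w, hw, Equiv.ofBijective f (Finite.injective_iff_bijective.1 hf), fun i j => ?_⟩
  rw [← h i i.2 j j.2]
  have h1 := (hlt i i.2).trans_eq ht.symm
  have h2 := (hlt j j.2).trans_eq ht.symm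
  change D.wt (t.getD (s.getD i 0) 0) (t.getD (s.getD j 0) 0) = _
  generalize s.getD i 0 = a at h1 ⊢
  generalize s.getD j 0 = b at h2 ⊢
  rw [List.getD_eq_getElem t 0 h1, List.getD_eq_getElem t 0 h2,
    List.getD_eq_getElem _ [] (by simpa using h1), List.getElem_map,
    List.getD_eq_getElem _ 0 (by simpa using h2), List.getElem_map]

theorem classified_of_check (hD : D.Valid cox)
    (hself : ∀ p < D.size, ∀ v < 2 * D.size, D.refl p (D.refl p v) = v)
    (hlen : D.rows.length = D.size) (hsize : 2 * D.size ≤ 128)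
    {diagrams : List (List (List ℕ))} {starts : List ℕ}
    (h : D.checkFactorizations diagrams starts = true) :
    (∀ q < D.size, ∃ k, D.coxeterAct^[k] q ∈ starts) ∧
    ∀ p ∈ starts, ∀ l : List ℕ, l.length + 1 = D.rank → (∀ q ∈ l, q < D.size) →
      (∀ v < 2 * D.size, D.coxeterFun v = (p :: l).foldr D.refl v) →
      D.classified diagrams (List.permutations' (List.range D.rank)) (p :: l) = true := by
  rw [checkFactorizations, forceLists_eq, Bool.and_eq_true] at h
  refine ⟨fun q hq => ?_, fun p hp l hk hl hf => ?_⟩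
  · obtain ⟨k, -, hk⟩ := List.any_eq_true.1 (allLt_iff.1 h.1 q hq)
    obtain ⟨p, hp, hpk⟩ := List.any_eq_true.1 hk
    exact ⟨k, by rwa [beq_eq_true_iff.1 hpk]⟩
  · have h' := List.all_eq_true.1 h.2 p hp
    rw [force_eq, Bool.and_eq_true, Nat.blt_eq] at h'
    obtain ⟨hp', hs⟩ := h'
    have hpack : ∀ v < 2 * D.size, entry (packRow ((List.range (2 * D.size)).map fun v =>
        D.refl p (D.coxeterFun v))) v = D.refl p (D.coxeterFun v) := fun v hv => by
      rw [entry_packRow]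
      · rw [List.getD_eq_getElem _ 0 (by simpa using hv), List.getElem_map, List.getElem_range]
      · simp only [List.mem_map, List.mem_range]
        rintro _ ⟨v, hv, rfl⟩
        exact (hD.refl_lt p hp' _ (hD.coxeterFun_lt hv)).trans_le hsize
    refine search_sound hD hself hlen hs (l := l) (by omega) hl fun v hv => ?_
    rw [hpack v hv, hf v hv, List.foldr_cons, hself p hp' _ (hD.foldr_refl_lt hl hv)]

end RootTable

/-! ### Coxeter elements -/

/-- If `g i` and `g j` commute unless `i` and `j` are adjacent, then all products of the `g i`, in
any order, are conjugate. -/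
theorem isConj_prod_range {G : Type*} [Group G] {n : ℕ} {g : ℕ → G}
    (hg : ∀ i j, i + 2 ≤ j → j < n → Commute (g i) (g j)) {l : List ℕ}
    (hl : l.Perm (List.range n)) : IsConj (l.map g).prod ((List.range n).map g).prod := by
  have key : ∀ j k, j + k = n → ∀ l : List ℕ, l.Perm (List.range j) →
      IsConj ((l ++ List.range' j k).map g).prod ((List.range n).map g).prod := by
    intro j
    induction j with
    | zero =>
      rintro k hk l hl
      obtain rfl : l = [] := by simpa using hl
      obtain rfl : k = n := by omega
      rw [List.nil_append, List.range_eq_range']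
    | succ j ih =>
      intro k hk l hl
      obtain ⟨a, b, rfl⟩ :=
        List.append_of_mem (hl.mem_iff.2 (List.mem_range.2 (Nat.lt_succ_self j)))
      have hperm : (b ++ a).Perm (List.range j) := by
        rw [List.range_succ] at hl
        exact List.perm_append_comm.trans
          ((List.perm_middle.symm.trans (hl.trans List.perm_append_comm)).cons_inv)
      have hcomm : Commute (b.map g).prod ((List.range' (j + 1) k).map g).prod := by
        refine Commute.list_prod_left _ _ fun x hx => Commute.list_prod_right _ _ fun y hy => ?_
        obtain ⟨i, hi, rfl⟩ := List.mem_map.1 hx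
        obtain ⟨i', hi', rfl⟩ := List.mem_map.1 hy
        have h1 : i < j := List.mem_range.1 (hperm.mem_iff.1 (by simp [hi]))
        have h2 := List.mem_range'_1.1 hi'
        exact hg i i' (by omega) (by omega)
      -- With `T` the product of the sorted tail, `b` commutes with `T`, so conjugating `a g_j b T`
      -- by `b` gives `b a g_j T`, where `j` has joined the tail.
      refine IsConj.trans ?_ (ih (k + 1) (by omega) _ hperm)
      refine isConj_iff.2 ⟨(b.map g).prod, ?_⟩
      simp only [List.map_append, List.prod_append, List.map_cons, List.prod_cons,
        List.range'_succ, mul_assoc]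
      rw [← mul_assoc (List.prod _) (List.prod _) (b.map g).prod⁻¹, hcomm.eq, mul_inv_cancel_right]
  have := key n 0 rfl l hl
  rwa [List.range'_zero, List.append_nil] at this

/-! ### Parity and conjugation of reflection factorizations -/

section Factorizations

variable {B W : Type*} [Group W] {M : CoxeterMatrix B} {cs : CoxeterSystem M W}

/-- The sign character takes the value -1 on every reflection. -/
theorem length_mod_two_eq {l l' : List W} (hl : ∀ x ∈ l, cs.IsReflection x)
    (hl' : ∀ x ∈ l', cs.IsReflection x) (h : l.prod = l'.prod) :
    l.length % 2 = l'.length % 2 := by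
  have key : ∀ l : List W, (∀ x ∈ l, cs.IsReflection x) →
      cs.lengthParity l.prod = Multiplicative.ofAdd (l.length : ZMod 2) := by
    intro l hl
    induction l with
    | nil => simp
    | cons x l ih =>
      have hx : cs.lengthParity x = Multiplicative.ofAdd 1 := by
        rw [cs.lengthParity_eq_ofAdd_length,
          ZMod.natCast_eq_one_iff_odd.2 (hl x (by simp)).odd_length]
      rw [List.prod_cons, map_mul, hx, ih fun y hy => hl y (by simp [hy]), ← ofAdd_add,
        List.length_cons, Nat.cast_succ, add_comm]
  have h1 := key l hl
  rw [h, key l' hl'] at h1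
  exact ((ZMod.natCast_eq_natCast_iff' _ _ 2).1 (Multiplicative.ofAdd.injective h1)).symm

theorem IsReducedReflectionFactorization.conj {w : W} {k : ℕ} {t : Fin k → W}
    (ht : IsReducedReflectionFactorization cs w t) (g : W) :
    IsReducedReflectionFactorization cs (g * w * g⁻¹) fun i => g * t i * g⁻¹ where
  isReflection i := (ht.isReflection i).conj g
  prod_eq := by
    have h := (map_list_prod (MulAut.conj g) (List.ofFn t)).symm
    rwa [List.map_ofFn, ht.prod_eq] at h
  minimal l hl hprod := by
    have h := map_list_prod (MulAut.conj g⁻¹) l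
    rw [hprod] at h
    have h' := ht.minimal (l.map (MulAut.conj g⁻¹)) ?_ (by
      rw [← h]
      simp [mul_assoc])
    · simpa using h'
    · intro x hx
      obtain ⟨y, hy, rfl⟩ := List.mem_map.1 hx
      exact (hl y hy).conj g⁻¹

theorem carterDiagram_conj {k : ℕ} (t : Fin k → W) (g : W) :
    carterDiagram (fun i => g * t i * g⁻¹) = carterDiagram t := by
  ext i j
  have h : g * t i * g⁻¹ * (g * t j * g⁻¹) = MulAut.conj g (t i * t j) :=
    (map_mul (MulAut.conj g) (t i) (t j)).symm
  simp only [carterDiagram, h, MulEquiv.orderOf_eq]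

theorem IsCoxeterElement.exists_eq_conj {c : W} (hc : IsCoxeterElement cs c) :
    ∃ (g : W) (l : List B), l.Nodup ∧ (∀ b, b ∈ l) ∧ c = g * (l.map cs.simple).prod * g⁻¹ := by
  obtain ⟨g, l, hl, hmem, rfl⟩ := hc
  refine ⟨g, l, hl, hmem, ?_⟩
  have h := map_list_prod (MulAut.conj g) (l.map cs.simple)
  rw [List.map_map] at h
  exact h.symm

end Factorizations

/-! ### Factorizations of the Coxeter element of a root table -/

namespace RootTable

variable {D : RootTable} {cox : ℕ → ℕ → ℕ} (hD : D.Valid cox) {W : Type*} [Group W]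
  {M : CoxeterMatrix (Fin D.rank)} {cs : CoxeterSystem M W} {x : ℕ → W}

namespace Realizes

theorem isReflection_of_mem (hx : D.Realizes cs x) {l : List ℕ} (hl : ∀ p ∈ l, p < D.size) :
    ∀ y ∈ l.map x, cs.IsReflection y := by
  intro y hy
  obtain ⟨p, hp, rfl⟩ := List.mem_map.1 hy
  exact (hx.isReflection_iff _).2 ⟨p, hl p hp, rfl⟩

include hD

theorem refl_refl (hx : D.Realizes cs x) : ∀ p < D.size, ∀ v < 2 * D.size,
    D.refl p (D.refl p v) = v := by
  obtain ⟨ρ, hρ⟩ := hx.exists_action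
  intro p hp v hv
  rw [← hρ p hp v hv, ← hρ p hp _ (by rw [hρ p hp v hv]; exact hD.refl_lt p hp v hv),
    ← Equiv.Perm.mul_apply, ← map_mul, hx.mul_self p hp, map_one, Equiv.Perm.one_apply]

theorem isConj_coxeter (hx : D.Realizes cs x)
    (hcomm : ∀ i j, i + 2 ≤ j → j < D.rank → D.act i j = j) {c : W}
    (hc : IsCoxeterElement cs c) : ∃ g, g * c * g⁻¹ = ((List.range D.rank).map x).prod := by
  obtain ⟨g, l, hl, hmem, rfl⟩ := hc.exists_eq_conj
  have hperm : (l.map Fin.val).Perm (List.range D.rank) :=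
    (List.perm_ext_iff_of_nodup (hl.map Fin.val_injective) List.nodup_range).2 fun i => by
      simp only [List.mem_map, List.mem_range]
      exact ⟨fun ⟨a, _, h⟩ => h ▸ a.2, fun h => ⟨⟨i, h⟩, hmem _, rfl⟩⟩
  have hconj := isConj_prod_range (g := x) (n := D.rank) (fun i j hij hj => by
    have hi : i < D.size := by have := hD.rank_le; omega
    have h := hx.conj i hi j (hj.trans_le hD.rank_le)
    rw [hcomm i j hij hj] at h
    calc x i * x j = x i * x j * (x i * x i) := by rw [hx.mul_self i hi, mul_one]
      _ = x j * x i := by rw [← mul_assoc, h]) hperm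
  have hmap : (l.map Fin.val).map x = l.map cs.simple := by
    rw [List.map_map]
    exact List.map_congr_left fun i _ => hx.simple i
  rw [hmap] at hconj
  obtain ⟨g', hg'⟩ := isConj_iff.1 hconj
  exact ⟨g' * g⁻¹, by rw [← hg']; group⟩

theorem conj_coxeter (hx : D.Realizes cs x) {q : ℕ} (hq : q < D.size) :
    ((List.range D.rank).map x).prod * x q * ((List.range D.rank).map x).prod⁻¹ =
      x (D.coxeterAct q) :=
  hx.prod_conj hD (b := id) (n := D.size) (fun _ h => h) hq
    fun _ hj => (List.mem_range.1 hj).trans_le hD.rank_le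

theorem coxeterAct_lt {q : ℕ} (hq : q < D.size) : D.coxeterAct q < D.size := by
  rw [coxeterAct]
  cases List.range D.rank with
  | nil => exact hq
  | cons => exact hD.act_lt _ _

theorem conj_coxeter_pow (hx : D.Realizes cs x) (k : ℕ) {q : ℕ} (hq : q < D.size) :
    D.coxeterAct^[k] q < D.size ∧ ((List.range D.rank).map x).prod ^ k * x q *
      (((List.range D.rank).map x).prod ^ k)⁻¹ = x (D.coxeterAct^[k] q) := by
  induction k generalizing q with
  | zero => simpa using hq
  | succ k ih =>
    obtain ⟨h1, h2⟩ := ih (coxeterAct_lt hD hq)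
    refine ⟨h1, ?_⟩
    rw [Function.iterate_succ_apply, ← h2, ← hx.conj_coxeter hD hq, pow_succ]
    group

theorem action_prod (ρ : W →* Equiv.Perm ℕ)
    (hρ : ∀ p < D.size, ∀ v < 2 * D.size, ρ (x p) v = D.refl p v) {l : List ℕ}
    (hl : ∀ p ∈ l, p < D.size) {v : ℕ} (hv : v < 2 * D.size) :
    ρ (l.map x).prod v = l.foldr D.refl v := by
  induction l with
  | nil => simp
  | cons p l ih =>
    have hl' : ∀ q ∈ l, q < D.size := fun q hq => hl q (by simp [hq])
    rw [List.map_cons, List.prod_cons, map_mul, Equiv.Perm.mul_apply, ih hl',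
      hρ p (hl p (by simp)) _ (hD.foldr_refl_lt hl' hv), List.foldr_cons]

theorem coxeter_pow_ne_one (hx : D.Realizes cs x) {m : ℕ}
    (hm : ∃ v < 2 * D.size, D.coxeterFun^[m] v ≠ v) :
    ((List.range D.rank).map x).prod ^ m ≠ 1 := by
  obtain ⟨v, hv, hne⟩ := hm
  obtain ⟨ρ, hρ⟩ := hx.exists_action
  intro h
  refine hne ?_
  have key : ∀ m v, v < 2 * D.size →
      ρ (((List.range D.rank).map x).prod ^ m) v = D.coxeterFun^[m] v := by
    intro m
    induction m with
    | zero => simp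
    | succ m ih =>
      intro v hv
      rw [pow_succ, map_mul, Equiv.Perm.mul_apply, action_prod hD ρ hρ
        (fun p hp => (List.mem_range.1 hp).trans_le hD.rank_le) hv, Function.iterate_succ_apply]
      exact ih _ (hD.coxeterFun_lt hv)
  rw [← key m v hv, h, map_one, Equiv.Perm.one_apply]

/-- A product of at most two reflections is killed by one of the exponents 1, 2, 3, 5, and the
Coxeter element is killed by none. So `2 < k ≤ D.rank ≤ 4`, and parity leaves one value. -/
theorem length_eq_rank (hx : D.Realizes cs x) (hrank₃ : 3 ≤ D.rank) (hrank₄ : D.rank ≤ 4)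
    (hpow : ∀ m ∈ [1, 2, 3, 5], ∃ v < 2 * D.size, D.coxeterFun^[m] v ≠ v)
    {k : ℕ} {t : Fin k → W}
    (ht : IsReducedReflectionFactorization cs ((List.range D.rank).map x).prod t) :
    k = D.rank := by
  have hrefl := hx.isReflection_of_mem (l := List.range D.rank)
    fun p hp => (List.mem_range.1 hp).trans_le hD.rank_le
  have hle : k ≤ D.rank := by simpa using ht.minimal _ hrefl rfl
  have hpar : k % 2 = D.rank % 2 := by
    have := length_mod_two_eq (cs := cs) (l := List.ofFn t) (fun y hy => by
      obtain ⟨i, rfl⟩ := List.mem_ofFn.1 hy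
      exact ht.isReflection i) hrefl ht.prod_eq
    simpa using this
  have hgt : 2 < k := by
    by_contra! hk
    have hprod := ht.prod_eq
    have hne : ∀ m ∈ [1, 2, 3, 5], ((List.range D.rank).map x).prod ^ m ≠ 1 := fun m hm =>
      hx.coxeter_pow_ne_one hD (hpow m hm)
    have hp : ∀ i, ∃ p < D.size, x p = t i := fun i =>
      (hx.isReflection_iff _).1 (ht.isReflection i)
    interval_cases k
    · exact hne 1 (by simp) (by rw [← hprod]; simp)
    · obtain ⟨p, hp, hp'⟩ := hp 0
      refine hne 2 (by simp) ?_
      rw [← hprod]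
      simpa [pow_two, ← hp'] using hx.mul_self p hp
    · obtain ⟨p, hp₀, hp'⟩ := hp 0
      obtain ⟨q, hq, hq'⟩ := hp 1
      refine hne (D.ord p q) ?_ ?_
      · rw [ord]
        cases Nat.beq p q <;> cases Nat.beq (D.act p q) q <;>
          cases Nat.beq (D.act p q) (D.act q p) <;> simp
      · rw [← hprod]
        simpa [← hp', ← hq'] using hx.pow_ord hD hp₀ hq
  omega

/-- A Coxeter group with a root table that passes the checks is presented by the Carter diagram of
any reduced reflection factorization of a Coxeter element. -/
theorem nonempty_carterDiagram_mulEquiv (hx : D.Realizes cs x)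
    (hM : ∀ i j : Fin D.rank, M i j = cox i j) (hrank₃ : 3 ≤ D.rank) (hrank₄ : D.rank ≤ 4)
    (hcomm : ∀ i j, i + 2 ≤ j → j < D.rank → D.act i j = j)
    (hpow : ∀ m ∈ [1, 2, 3, 5], ∃ v < 2 * D.size, D.coxeterFun^[m] v ≠ v)
    (hlen : D.rows.length = D.size) (hsize : 2 * D.size ≤ 128)
    {diagrams : List (List ℕ × List (List ℕ))} {starts : List ℕ}
    (hdiag : ∀ d ∈ diagrams, D.checkDiagram d.1 d.2 = true)
    (hfact : D.checkFactorizations (diagrams.map Prod.snd) starts = true)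
    {c : W} (hc : IsCoxeterElement cs c) {k : ℕ} {t : Fin k → W}
    (ht : IsReducedReflectionFactorization cs c t) :
    Nonempty ((carterDiagram t).presentedGroup ≃* W) := by
  obtain ⟨g, hg⟩ := hx.isConj_coxeter hD hcomm hc
  have ht₁ := ht.conj g
  rw [hg] at ht₁
  rw [← carterDiagram_conj t g]
  generalize (fun i => g * t i * g⁻¹) = t₁ at ht₁ ⊢
  clear ht hc hg g c t
  obtain rfl := hx.length_eq_rank hD hrank₃ hrank₄ hpow ht₁
  have hpos : 0 < D.rank := hD.rank_pos
  obtain ⟨hstart, hclass⟩ := classified_of_check hD (hx.refl_refl hD) hlen hsize hfact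
  choose p hp hpx using fun i => (hx.isReflection_iff _).1 (ht₁.isReflection i)
  -- Conjugation by the `m`-th power of the Coxeter element fixes that element and moves the first
  -- factor into `starts`.
  obtain ⟨m, hm⟩ := hstart _ (hp ⟨0, hpos⟩)
  have hlt := fun i => (hx.conj_coxeter_pow hD m (hp i)).1
  have hqx := fun i => (hx.conj_coxeter_pow hD m (hp i)).2.symm
  have ht₂ := ht₁.conj (((List.range D.rank).map x).prod ^ m)
  rw [((Commute.refl _).pow_left m).eq, mul_inv_cancel_right] at ht₂
  rw [← carterDiagram_conj t₁ (((List.range D.rank).map x).prod ^ m)]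
  simp only [hpx] at hqx
  obtain ⟨q, hq⟩ : ∃ q : Fin D.rank → ℕ, ∀ i, q i = D.coxeterAct^[m] (p i) := ⟨_, fun _ => rfl⟩
  simp only [← hq] at hm hlt hqx
  have hofFn : (List.ofFn q).map x = List.ofFn fun i =>
      ((List.range D.rank).map x).prod ^ m * t₁ i * (((List.range D.rank).map x).prod ^ m)⁻¹ := by
    rw [List.map_ofFn]
    exact congrArg List.ofFn (funext hqx)
  have hmem : ∀ a ∈ List.ofFn q, a < D.size := fun a ha => by
    obtain ⟨i, rfl⟩ := List.mem_ofFn.1 ha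
    exact hlt i
  obtain ⟨ρ, hρ⟩ := hx.exists_action
  have hfun : ∀ v < 2 * D.size, D.coxeterFun v = (List.ofFn q).foldr D.refl v := fun v hv => by
    rw [← action_prod hD ρ hρ hmem hv, hofFn, ht₂.prod_eq, action_prod hD ρ hρ
      (fun p hp => (List.mem_range.1 hp).trans_le hD.rank_le) hv]
    rfl
  have hget : ∀ i : Fin D.rank, (List.ofFn q).getD i 0 = q i := fun i => by
    rw [List.getD_eq_getElem _ 0 (by simp), List.getElem_ofFn]
  have hlength : (List.ofFn q).length = D.rank := List.length_ofFn
  have hcl : D.classified (diagrams.map Prod.snd) (List.permutations' (List.range D.rank))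
      (List.ofFn q) = true := by
    have h0 := hget ⟨0, hpos⟩
    cases hl : List.ofFn q with
    | nil =>
      rw [hl] at hlength
      exact absurd hlength hpos.ne
    | cons a l =>
      rw [hl] at hlength hmem hfun h0
      obtain rfl : a = q ⟨0, hpos⟩ := h0
      exact hclass _ hm l hlength (fun b hb => hmem b (by simp [hb])) hfun
  obtain ⟨w, hw, σ, hσ⟩ := exists_perm_of_classified hlength hcl
  obtain ⟨d, hd, rfl⟩ := List.mem_map.1 hw
  refine hx.nonempty_mulEquiv hD hM hrank₄ (generates_of_check (hdiag d hd)) σ fun i j => ?_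
  rw [hx.carterDiagram_weight hD hlt hqx, ← hσ i j, hget, hget]

end Realizes

end RootTable

/-! ### The tables of types `H₃` and `H₄` -/

/-- All the checks for a root table. -/
def RootTable.check (D : RootTable) (cox : List (List ℕ))
    (diagrams : List (List ℕ × List (List ℕ))) (starts : List ℕ) : Bool :=
  Nat.ble 3 D.rank && Nat.ble D.rank 4 && Nat.ble D.rank D.size && Nat.ble (2 * D.size) 128 &&
  Nat.beq D.rows.length D.size && D.checkSimple cox && allLt D.size D.checkRow &&
  -- With truncated subtraction, `i < j - 1` means `i + 2 ≤ j`: non-neighbours on the path-shaped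
  -- Coxeter diagram commute.
  (allLt D.rank fun j => allLt (j - 1) fun i => Nat.beq (D.act i j) j) &&
  ([1, 2, 3, 5].all fun m => (List.range (2 * D.size)).any fun v =>
    !Nat.beq (D.coxeterFun^[m] v) v) &&
  -- One listed diagram must be that of the simple reflections and have no cycle relators; it serves
  -- to label the reflections of `W`.
  (diagrams.any fun d => D.checkDiagram d.1 d.2 &&
    (allLt D.rank fun i => Nat.beq (d.1.getD i 0) i) &&
    (relatorsOf D.rank fun i j => (d.2.getD i []).getD j 0).all fun r => r.u.isEmpty) &&
  (diagrams.all fun d => D.checkDiagram d.1 d.2) &&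
  D.checkFactorizations (diagrams.map Prod.snd) starts

theorem RootTable.nonempty_mulEquiv_of_check {D : RootTable} {cox : List (List ℕ)}
    {diagrams : List (List ℕ × List (List ℕ))} {starts : List ℕ}
    (h : D.check cox diagrams starts = true) {W : Type*} [Group W]
    {M : CoxeterMatrix (Fin D.rank)} (cs : CoxeterSystem M W)
    (hM : ∀ i j : Fin D.rank, M i j = (cox.getD i []).getD j 0)
    {c : W} (hc : IsCoxeterElement cs c) {k : ℕ} {t : Fin k → W}
    (ht : IsReducedReflectionFactorization cs c t) :
    Nonempty ((carterDiagram t).presentedGroup ≃* W) := by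
  simp only [RootTable.check, Bool.and_eq_true, Nat.ble_eq, Nat.beq_eq, and_assoc] at h
  obtain ⟨h3, h4, hsize, h128, hlen, hsimple, hrow, hcomm, hpow, hstd, hdiag, hfact⟩ := h
  have hD := RootTable.Valid.of_check (by omega) hsize hsimple hrow
  obtain ⟨d, -, hd⟩ := List.any_eq_true.1 hstd
  simp only [Bool.and_eq_true, allLt_iff, Nat.beq_eq] at hd
  obtain ⟨x, hx⟩ := hD.exists_realizes cs hM (generates_of_check hd.1.1) hd.1.2 hd.2
  refine hx.nonempty_carterDiagram_mulEquiv hD hM h3 h4 (fun i j hij hj => ?_) (fun m hm => ?_)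
    hlen h128 (List.all_eq_true.1 hdiag) hfact hc ht
  · exact beq_eq_true_iff.1 (allLt_iff.1 (allLt_iff.1 hcomm j hj) i (by omega))
  · obtain ⟨v, hv, hne⟩ := List.any_eq_true.1 (List.all_eq_true.1 hpow m hm)
    rw [Bool.not_eq_true', beq_eq_false_iff] at hne
    exact ⟨v, List.mem_range.1 hv, hne⟩

def h3Rows : List ℕ := tableRows 15
  [[0, 3, 2, 1, 6, 8, 4, 10, 5, 11, 7, 9, 13, 12, 14],
   [3, 1, 5, 0, 7, 2, 9, 4, 8, 6, 11, 10, 12, 14, 13],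
   [0, 4, 2, 6, 1, 7, 3, 5, 10, 12, 8, 13, 9, 11, 14]]

/-- The Carter diagrams in type `H₃`, each with a tuple of reflections realizing it. -/
def h3Diagrams : List (List ℕ × List (List ℕ)) :=
  [([0, 1, 2], [[0, 1, 0], [1, 0, 3], [0, 3, 0]]),
   ([2, 1, 3], [[0, 3, 3], [3, 0, 1], [3, 1, 0]]),
   ([10, 13, 6], [[0, 3, 3], [3, 0, 3], [3, 3, 0]])]

/-- The last list meets every orbit of the Coxeter element on the 15 reflections. -/
theorem check_h3 : (forceList h3Rows fun rows => (RootTable.mk 3 15 rows).check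
    [[1, 3, 2], [3, 1, 5], [2, 5, 1]] h3Diagrams [0, 2, 3]) = true := by
  decide +kernel

def h4Rows : List ℕ := tableRows 60
  [[0, 4, 2, 3, 1, 8, 6, 7, 5, 12, 10, 15, 9, 16, 19, 11, 13, 22, 21, 14, 24, 18, 17, 26, 20, 28,
    23, 30, 25, 31, 27, 29, 35, 33, 34, 32, 38, 37, 36, 42, 40, 45, 39, 46, 44, 41, 43, 48, 47,
    50, 49, 53, 52, 51, 54, 55, 56, 57, 59, 58],
   [4, 1, 5, 3, 0, 2, 9, 11, 8, 6, 14, 7, 12, 17, 10, 15, 20, 13, 23, 19, 16, 25, 24, 18, 22, 21,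
    28, 27, 26, 29, 33, 34, 32, 30, 31, 37, 39, 35, 41, 36, 43, 38, 45, 40, 47, 42, 46, 44, 48,
    49, 52, 51, 50, 54, 53, 55, 56, 58, 57, 59],
   [0, 5, 2, 7, 8, 1, 10, 3, 4, 13, 6, 11, 16, 9, 17, 15, 12, 14, 18, 22, 20, 21, 19, 27, 24, 29,
    30, 23, 31, 25, 26, 28, 36, 34, 33, 38, 32, 40, 35, 39, 37, 43, 42, 41, 44, 46, 45, 49, 50,
    47, 48, 51, 52, 53, 55, 54, 57, 56, 58, 59],
   [0, 1, 6, 3, 4, 9, 2, 10, 12, 5, 7, 14, 8, 18, 11, 19, 21, 23, 13, 15, 25, 16, 26, 17, 28, 20,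
    22, 27, 24, 32, 30, 35, 29, 33, 37, 31, 36, 34, 38, 39, 44, 41, 42, 47, 40, 45, 48, 43, 46,
    51, 53, 49, 54, 50, 52, 56, 55, 57, 58, 59]]

/-- The Carter diagrams in type `H₄`, each with a tuple of reflections realizing it. -/
def h4Diagrams : List (List ℕ × List (List ℕ)) :=
  [([0, 1, 2, 3], [[0, 1, 0, 0], [1, 0, 1, 0], [0, 1, 0, 3], [0, 0, 3, 0]]),
   ([0, 3, 2, 5], [[0, 0, 0, 1], [0, 0, 3, 3], [0, 3, 0, 1], [1, 3, 1, 0]]),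
   ([1, 12, 3, 2], [[0, 0, 0, 1], [0, 0, 3, 3], [0, 3, 0, 3], [1, 3, 3, 0]]),
   ([1, 12, 7, 2], [[0, 0, 3, 1], [0, 0, 1, 3], [3, 1, 0, 3], [1, 3, 3, 0]]),
   ([3, 4, 2, 1], [[0, 0, 3, 0], [0, 0, 1, 1], [3, 1, 0, 1], [0, 1, 1, 0]]),
   ([3, 2, 5, 8], [[0, 3, 3, 3], [3, 0, 1, 1], [3, 1, 0, 1], [3, 1, 1, 0]]),
   ([12, 3, 2, 5], [[0, 3, 3, 3], [3, 0, 3, 3], [3, 3, 0, 1], [3, 3, 1, 0]]),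
   ([12, 11, 1, 2], [[0, 1, 0, 3], [1, 0, 3, 0], [0, 3, 0, 1], [3, 0, 1, 0]])]

theorem check_h4 : (forceList h4Rows fun rows => (RootTable.mk 4 60 rows).check
    [[1, 3, 2, 2], [3, 1, 3, 2], [2, 3, 1, 5], [2, 2, 5, 1]] h4Diagrams [0, 3, 4, 6]) = true := by
  decide +kernel

theorem nonempty_mulEquiv_of_h3 {W : Type*} [Group W] (cs : CoxeterSystem CoxeterMatrix.H₃ W)
    {c : W} (hc : IsCoxeterElement cs c) {k : ℕ} {t : Fin k → W}
    (ht : IsReducedReflectionFactorization cs c t) :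
    Nonempty ((carterDiagram t).presentedGroup ≃* W) := by
  have h := check_h3
  rw [forceList_eq] at h
  refine RootTable.nonempty_mulEquiv_of_check h cs (fun i j => ?_) hc ht
  change Fin 3 at i j
  fin_cases i <;> fin_cases j <;> rfl

theorem nonempty_mulEquiv_of_h4 {W : Type*} [Group W] (cs : CoxeterSystem CoxeterMatrix.H₄ W)
    {c : W} (hc : IsCoxeterElement cs c) {k : ℕ} {t : Fin k → W}
    (ht : IsReducedReflectionFactorization cs c t) :
    Nonempty ((carterDiagram t).presentedGroup ≃* W) := by
  have h := check_h4
  rw [forceList_eq] at h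
  refine RootTable.nonempty_mulEquiv_of_check h cs (fun i j => ?_) hc ht
  change Fin 4 at i j
  fin_cases i <;> fin_cases j <;> rfl

/-! ### Dihedral groups -/

section Dihedral

variable {W : Type*} [Group W]

/-- Two vertices leave no room for a cycle, so the cycle relations are vacuous. -/
theorem Diagram.relations_of_fin_two {G : Type*} [Group G] {Γ : Diagram (Fin 2)} {g : Fin 2 → G}
    (hg : ∀ i, g i * g i = 1) (h : (g 0 * g 1) ^ (Γ.weight 0 1 + 2) = 1) : Γ.Relations g := by
  have h' : (g 1 * g 0) ^ (Γ.weight 1 0 + 2) = 1 := by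
    rw [Γ.symm, ← orderOf_dvd_iff_pow_eq_one, ← orderOf_mul_swap, orderOf_dvd_iff_pow_eq_one, h]
  have hcyc : ∀ a b c, Γ.weight a b ≠ 0 → Γ.weight b c ≠ 0 → Γ.weight c a ≠ 0 → False := by
    intro a b c h1 h2 h3
    have := Γ.ne_of_weight_ne_zero h1
    have := Γ.ne_of_weight_ne_zero h2
    have := Γ.ne_of_weight_ne_zero h3
    omega
  refine ⟨hg, fun i j hij => ?_, fun a b c h1 h2 h3 => (hcyc a b c h1 h2 h3).elim,
    fun a b c d n1 n2 z1 z2 h1 h2 => ?_,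
    fun a b c h1 h2 h3 => (hcyc a b c (by omega) (by omega) (by omega)).elim,
    fun a b c h1 h2 h3 => (hcyc a b c (by omega) (by omega) (by omega)).elim⟩
  · fin_cases i <;> fin_cases j
    exacts [absurd rfl hij, h, h', absurd rfl hij]
  · have := Γ.ne_of_weight_ne_zero h1
    have := Γ.ne_of_weight_ne_zero h2
    omega

/-- The Coxeter relation bounds the order from above; the image in `DihedralGroup (m + 2)` is a
rotation of exact order `m + 2`. -/
theorem orderOf_simple_mul_simple {m : ℕ} (cs : CoxeterSystem (CoxeterMatrix.I m) W) :
    orderOf (cs.simple 0 * cs.simple 1) = m + 2 := by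
  refine Nat.dvd_antisymm (orderOf_dvd_of_pow_eq_one (cs.simple_mul_simple_pow 0 1)) ?_
  have hr : ∀ i : ZMod (m + 2), (DihedralGroup.r i) ^ (m + 2) = 1 := fun i => by
    rw [DihedralGroup.r_pow, Nat.cast_add, Nat.cast_ofNat]
    have : ((m + 2 : ℕ) : ZMod (m + 2)) = 0 := ZMod.natCast_self _
    push_cast at this
    rw [this, mul_zero, DihedralGroup.r_zero]
  let f : W →* DihedralGroup (m + 2) := cs.lift ⟨fun i => .sr (i.val : ZMod (m + 2)), fun i j => by
    dsimp only
    rw [DihedralGroup.sr_mul_sr]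
    by_cases hij : i = j
    · subst hij
      rw [sub_self, DihedralGroup.r_zero, one_pow]
    · have : CoxeterMatrix.I m i j = m + 2 := if_neg hij
      rw [this, hr]⟩
  have hf : f (cs.simple 0 * cs.simple 1) = .r 1 := by
    have hfs : ∀ i, f (cs.simple i) = .sr (i.val : ZMod (m + 2)) := fun i =>
      cs.lift_apply_simple _ _
    rw [map_mul, hfs, hfs, DihedralGroup.sr_mul_sr]
    simp
  have := orderOf_map_dvd f (cs.simple 0 * cs.simple 1)
  rwa [hf, DihedralGroup.orderOf_r_one] at this

theorem nonempty_mulEquiv_of_dihedral {m : ℕ} (cs : CoxeterSystem (CoxeterMatrix.I m) W)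
    {c : W} (hc : IsCoxeterElement cs c) {k : ℕ} {t : Fin k → W}
    (ht : IsReducedReflectionFactorization cs c t) :
    Nonempty ((carterDiagram t).presentedGroup ≃* W) := by
  obtain ⟨g, l, hl, hmem, rfl⟩ := hc.exists_eq_conj
  have hperm : l.Perm [0, 1] := (List.perm_ext_iff_of_nodup hl (by decide)).2 fun i => by
    fin_cases i <;> simp [hmem]
  have horder : orderOf (g * (l.map cs.simple).prod * g⁻¹) = m + 2 := by
    rw [show g * (l.map cs.simple).prod * g⁻¹ = MulAut.conj g (l.map cs.simple).prod from rfl,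
      MulEquiv.orderOf_eq]
    rcases List.perm_pair.1 hperm with rfl | rfl
    · simpa using orderOf_simple_mul_simple cs
    · simpa [orderOf_mul_swap (cs.simple 1)] using orderOf_simple_mul_simple cs
  obtain ⟨L, hL, hL2, hLprod⟩ : ∃ L : List W, (∀ x ∈ L, cs.IsReflection x) ∧ L.length = 2 ∧
      L.prod = g * (l.map cs.simple).prod * g⁻¹ := by
    refine ⟨(l.map cs.simple).map (MulAut.conj g), fun x hx => ?_, by simpa using hperm.length_eq,
      (map_list_prod (MulAut.conj g) _).symm⟩
    simp only [List.mem_map] at hx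
    obtain ⟨_, ⟨i, -, rfl⟩, rfl⟩ := hx
    exact (cs.isReflection_simple i).conj g
  generalize g * (l.map cs.simple).prod * g⁻¹ = c at *
  -- Minimality gives `k ≤ 2`, parity excludes 1, and `c` has order `m + 2 ≥ 2`, which excludes 0.
  obtain rfl : k = 2 := by
    have hle := ht.minimal L hL hLprod
    have hpar := length_mod_two_eq (cs := cs) (l := List.ofFn t) (fun y hy => by
      obtain ⟨i, rfl⟩ := List.mem_ofFn.1 hy
      exact ht.isReflection i) hL (ht.prod_eq.trans hLprod.symm)
    rw [List.length_ofFn, hL2] at hpar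
    have hne : k ≠ 0 := by
      rintro rfl
      have : c = 1 := by simpa using ht.prod_eq.symm
      rw [this, orderOf_one] at horder
      omega
    omega
  have hprod : t 0 * t 1 = c := by simpa using ht.prod_eq
  have hweight : (carterDiagram t).weight 0 1 = m := by
    change (if (0 : Fin 2) = 1 then 0 else orderOf (t 0 * t 1) - 2) = m
    rw [if_neg (by decide), hprod, horder, Nat.add_sub_cancel]
  generalize carterDiagram t = Γ at hweight
  have hW : Γ.Relations cs.simple := by
    refine Diagram.relations_of_fin_two cs.simple_mul_simple_self ?_
    rw [hweight]
    exact cs.simple_mul_simple_pow 0 1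
  let of : Fin 2 → Γ.presentedGroup := PresentedGroup.of
  have hof : Γ.Relations of := Γ.relations_of
  let α : Γ.presentedGroup →* W := PresentedGroup.toGroup (hW.lift_eq_one (by simp))
  have hα : ∀ i, α (of i) = cs.simple i := fun i => PresentedGroup.toGroup.of _
  let β : W →* Γ.presentedGroup := cs.lift ⟨of, fun i j => by
    by_cases hij : i = j
    · subst hij
      rw [hof.mul_self, one_pow]
    · have h := hof.pow_eq i j hij
      have h1 : Γ.weight i j = m := by
        fin_cases i <;> fin_cases j
        exacts [absurd rfl hij, hweight, (Γ.symm _ _).trans hweight, absurd rfl hij]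
      have h2 : CoxeterMatrix.I m i j = m + 2 := if_neg hij
      rwa [h1, ← h2] at h⟩
  have hβ : ∀ i, β (cs.simple i) = of i := fun i => cs.lift_apply_simple _ _
  refine ⟨α.toMulEquiv β (PresentedGroup.ext fun i => ?_) (cs.ext_simple fun i => ?_)⟩
  · exact (congrArg β (hα i)).trans (hβ i)
  · exact (congrArg α (hβ i)).trans (hα i)

end Dihedral

/-! ### Relabelling -/

section Reindex

variable {B B' W : Type*} [Group W] {M : CoxeterMatrix B} {cs : CoxeterSystem M W} (e : B ≃ B')

theorem isReflection_reindex {w : W} : (cs.reindex e).IsReflection w ↔ cs.IsReflection w :=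
  ⟨fun ⟨g, i, h⟩ => ⟨g, e.symm i, h⟩, fun ⟨g, i, h⟩ => ⟨g, e i, by simpa using h⟩⟩

theorem IsCoxeterElement.reindex {c : W} (hc : IsCoxeterElement cs c) :
    IsCoxeterElement (cs.reindex e) c := by
  obtain ⟨g, l, hl, hmem, rfl⟩ := hc
  refine ⟨g, l.map e, hl.map e.injective, fun b => ?_, ?_⟩
  · exact List.mem_map.2 ⟨e.symm b, hmem _, by simp⟩
  · simp [Function.comp_def]

theorem IsReducedReflectionFactorization.reindex {w : W} {k : ℕ} {t : Fin k → W}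
    (ht : IsReducedReflectionFactorization cs w t) :
    IsReducedReflectionFactorization (cs.reindex e) w t where
  isReflection i := (isReflection_reindex e).2 (ht.isReflection i)
  prod_eq := ht.prod_eq
  minimal l hl := ht.minimal l fun x hx => (isReflection_reindex e).1 (hl x hx)

end Reindex

end CarterPresentation

theorem mainTheorem8 {B W : Type*} [Group W] {M : CoxeterMatrix B} (cs : CoxeterSystem M W)
    (hM : CarterPresentation.IsTypeHOrI M) (c : W) (hc : CarterPresentation.IsCoxeterElement cs c)
    {k : ℕ} (t : Fin k → W)
    (ht : CarterPresentation.IsReducedReflectionFactorization cs c t) :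
    Nonempty ((CarterPresentation.carterDiagram t).presentedGroup ≃* W) := by
  rcases hM with ⟨e, he⟩ | ⟨e, he⟩ | ⟨m, e, he⟩
  all_goals
    have hc' := hc.reindex e
    have ht' := ht.reindex e
    generalize cs.reindex e = cs' at hc' ht'
    -- The type of `cs'` mentions the reindexed matrix, so it has to be generalized before that
    -- matrix is replaced.
    revert cs'
    rw [he]
    intro cs' hc' ht'

  · exact CarterPresentation.nonempty_mulEquiv_of_h3 cs' hc' ht'
  · exact CarterPresentation.nonempty_mulEquiv_of_h4 cs' hc' ht'
  · exact CarterPresentation.nonempty_mulEquiv_of_dihedral cs' hc' ht'
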